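/- Let $\hbar>0$ and let $H_0$ be a self-adjoint operator on a Hilbert space $\mathcal H$ with an orthonormal basis of eigenvectors $(e_n)_{n\in J}$, $J\subseteq\mathbb N$, $H_0e_n=E_0(n)e_n$, the real eigenvalues $E_0(n)$ being pairwise distinct. Let $V$ be a bounded self-adjoint operator on $\mathcal H$, put $$\mathcal N=\Big\{\tfrac1{i\hbar}\big(E_0(k)-E_0(\ell)\big)\;\Big|\;k,\ell\in J\Big\},$$ and for $\lambda\in\mathcal N$ let $$V_\lambda=\sum_{(k,\ell)\,:\,E_0(k)-E_0(\ell)=i\hbar\lambda}(e_k,Ve_\ell)\,|e_k\rangle\langle e_\ell|,$$ so that $\frac1{i\hbar}[H_0,V_\lambda]=\lambda V_\lambda$ and $V=\sum_{\lambda\in\mathcal N}V_\lambda$. Assume that $V$ is finite-band, i.e. only finitely many $V_\lambda$ are nonzero. All operators below are considered on $\operatorname{Span}_{\mathbb C}(e_n)_{n\in J}$, which $H_0$, $V$ and the $V_\lambda$ preserve. *Normal form.* There are formal series $W=\sum_{k\ge1}W_k\mu^k$ and $N=\sum_{k\ge1}N_k\mu^k$, whose coefficients are operators on $\operatorname{Span}_{\mathbb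 C}(e_n)$, the $W_k$ being symmetric, such that, as formal series in $\mu$, $$e^{\frac1{i\hbar}W}\,(H_0+\mu V)\,e^{-\frac1{i\hbar}W}=H_0+N,\qquad [H_0,N]=0.\tag{1}$$ In any such pair $N_k$ is the order-$k$ Rayleigh–Schrödinger normal-form term. *Birkhoff decomposition.* Let $\underline{\mathcal N}$ be the set of words (finite sequences) on the alphabet $\mathcal N$, with empty word $\emptyset$, and let $K=\mathbb C((\varepsilon))$, $K_+=\mathbb C[[\varepsilon]]$, $K_-=\varepsilon^{-1}\mathbb C[\varepsilon^{-1}]$. For $M,M':\underline{\mathcal N}\to K$ put $(M\times M')^{w}=\sum_{ab=w}M^{a}M'^{b}$, the sum being over all factorizations $w=ab$ by concatenation. Let $$T^{\lambda_1\cdots\lambda_r}(\varepsilon)=\prod_{j=1}^r\frac1{\lambda_1+\cdots+\lambda_j+j\varepsilon}\in K .$$ There is a unique pair $(U_+,U_-)$ of functions $\underline{\mathcal N}\to K$ such that $U_\pm^{\emptyset}=1$, $U_-^{w}\in K_-$ for every $w\neq\emptyset$, $U_+^{w}\in K_+$ for every $w$, and $U_-\times T=U_+$. **Theorem.** For every $k\ge1$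 and every pair $(W,N)$ as in (1), $$N_k=\sum_{\lambda_1,\dots,\lambda_k\in\mathcal N}N^{\lambda_1\cdots\lambda_k}\;\tfrac1{i\hbar}\big[V_{\lambda_1},\tfrac1{i\hbar}[V_{\lambda_2},\dots\tfrac1{i\hbar}[V_{\lambda_{k-1}},V_{\lambda_k}]\dots]\big],$$ where only finitely many terms are nonzero (for $k=1$ the iterated bracket is $V_{\lambda_1}$), and $$N^{\lambda_1\cdots\lambda_k}=-\operatorname{Res}U_-^{\lambda_1\cdots\lambda_k}=-\big[\varepsilon\,U_-^{\lambda_1\cdots\lambda_k}(\varepsilon)\big]_{\varepsilon=\infty},$$ the residue being the coefficient of $\varepsilon^{-1}$. -/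

import Mathlib

open scoped LaurentSeries

noncomputable section

/-! Moulds and Birkhoff decomposition -/

/-- A mould on the alphabet `α` with values in the field `ℂ((ε))` of formal Laurent series:
a family of Laurent series indexed by the words (finite sequences) on `α`. -/
abbrev Mould (α : Type*) := List α → ℂ⸨X⸩

namespace Mould

variable {α : Type*}

/-- The unit mould: `1` on the empty word and `0` on every other word. -/
def one : Mould α
  | [] => 1
  | _ :: _ => 0

/-- Mould multiplication: `(M × N)^w` is the sum of `M^a N^b` over all the factorizations
`w = a b`. -/
def mul (M N : Mould α) : Mould α :=
  fun w => ∑ i ∈ Finset.range (w.length + 1), M (w.take i) * N (w.drop i)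

end Mould

/-- The indeterminate `ε`, as a Laurent series. -/
def laurentEps : ℂ⸨X⸩ := HahnSeries.single (1 : ℤ) (1 : ℂ)

/-- `x` belongs to `K₊ = ℂ[[ε]]`. -/
def IsRegularPart (x : ℂ⸨X⸩) : Prop := ∀ n : ℤ, n < 0 → x.coeff n = 0

/-- `x` belongs to `K₋ = ε⁻¹ ℂ[ε⁻¹]`.  (A Laurent series has only finitely many terms of
negative degree, so a series with no term of degree `≥ 0` is a polynomial in `ε⁻¹` without
constant term.) -/
def IsPolarPart (x : ℂ⸨X⸩) : Prop := ∀ n : ℤ, 0 ≤ n → x.coeff n = 0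

/-- The residue of a Laurent series: the coefficient of `ε⁻¹`. -/
def laurentResidue (x : ℂ⸨X⸩) : ℂ := x.coeff (-1)

/-- `x` is a polynomial in `ε⁻¹`, and `c` is its value at `ε = ∞`, that is at `ε⁻¹ = 0`. -/
def HasValueAtInfinity (x : ℂ⸨X⸩) (c : ℂ) : Prop :=
  ∃ p : Polynomial ℂ, x = Polynomial.aeval laurentEps⁻¹ p ∧ p.eval 0 = c

/-- The mould `T^{n₁⋯n_r}(ε) = ∏_{j=1}^r (φ(n₁) + ⋯ + φ(n_j) + j ε)⁻¹`. -/
def regularizedMould {α : Type*} (φ : α → ℂ) : Mould α := fun w =>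
  ∏ j ∈ Finset.range w.length,
    (HahnSeries.C ((w.take (j + 1)).map φ).sum + ((j + 1 : ℕ) : ℂ⸨X⸩) * laurentEps)⁻¹

/-- `(Uplus, Uminus)` is a Birkhoff decomposition of the mould `T`. -/
structure IsBirkhoffDecomposition {α : Type*} (T Uplus Uminus : Mould α) : Prop where
  plus_nil : Uplus [] = 1
  minus_nil : Uminus [] = 1
  minus_polar : ∀ w, IsPolarPart (Uminus w - Mould.one w)
  plus_regular : ∀ w, IsRegularPart (Uplus w)
  mul_eq : Uminus.mul T = Uplus

/-! Formal perturbation theory in an associative algebra -/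

section Formal

variable {A : Type*} [Ring A] [Algebra ℂ A]

/-- The bracket `(1/iħ)[a, b]`. -/
def quantumBracket (hbar : ℝ) (a b : A) : A :=
  (Complex.I * (hbar : ℂ))⁻¹ • (a * b - b * a)

/-- The iterated bracket `(1/iħ)[a₁, (1/iħ)[a₂, … (1/iħ)[a_{k-1}, a_k] … ]]` of a nonempty list
(it is `a₁` if `k = 1`). -/
def nestedBracket (hbar : ℝ) : List A → A
  | [] => 0
  | [a] => a
  | a :: b :: l => quantumBracket hbar a (nestedBracket hbar (b :: l))

/-- The exponential `∑ Y^j / j!` of a formal series `Y` with zero constant term.  Only the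
indices `j ≤ n` contribute to the coefficient of degree `n`. -/
def formalExp (Y : PowerSeries A) : PowerSeries A :=
  PowerSeries.mk fun n =>
    ∑ j ∈ Finset.range (n + 1), ((j.factorial : ℂ)⁻¹) • PowerSeries.coeff n (Y ^ j)

end Formal

/-! Hamiltonians with simple point spectrum -/

/-- A self-adjoint, possibly unbounded, operator `op` on the Hilbert space `H`, with an orthonormal
basis of eigenvectors `e n`, `n ∈ J ⊆ ℕ`, and simple eigenvalues `E n`. -/
structure SimpleHamiltonian (H : Type*) [NormedAddCommGroup H] [InnerProductSpace ℂ H]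
    [CompleteSpace H] (J : Set ℕ) where
  op : H →ₗ.[ℂ] H
  selfAdjoint : IsSelfAdjoint op
  e : HilbertBasis J ℂ H
  E : J → ℝ
  simple : Function.Injective E
  eigen : ∀ n, ∃ h : e n ∈ op.domain, op ⟨e n, h⟩ = (E n : ℂ) • e n

namespace SimpleHamiltonian

variable {H : Type*} [NormedAddCommGroup H] [InnerProductSpace ℂ H] [CompleteSpace H] {J : Set ℕ}
  (S : SimpleHamiltonian H J)

/-- The dense subspace of finite linear combinations of the eigenvectors. -/
abbrev core : Submodule ℂ H := Submodule.span ℂ (Set.range S.e)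

/-- The eigenvectors, as an algebraic basis of their span. -/
def coreBasis : Module.Basis J ℂ S.core := Module.Basis.span S.e.orthonormal.linearIndependent

theorem coe_coreBasis (n : J) : (S.coreBasis n : H) = S.e n := by
  simp [coreBasis, Module.Basis.span_apply]

theorem core_le_domain : S.core ≤ S.op.domain := by
  rw [Submodule.span_le]
  rintro _ ⟨n, rfl⟩
  exact (S.eigen n).1

theorem op_mem_core (x : S.core) : S.op ⟨x, S.core_le_domain x.2⟩ ∈ S.core := by
  have key : S.core ≤ (S.core.comap S.op.toFun).map S.op.domain.subtype := by
    rw [Submodule.span_le]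
    rintro _ ⟨n, rfl⟩
    obtain ⟨h, hn⟩ := S.eigen n
    refine ⟨⟨S.e n, h⟩, ?_, rfl⟩
    change S.op ⟨S.e n, h⟩ ∈ S.core
    rw [hn]
    exact S.core.smul_mem _ (Submodule.subset_span ⟨n, rfl⟩)
  obtain ⟨y, hy, hyx⟩ := key x.2
  have : y = ⟨x, S.core_le_domain x.2⟩ := Subtype.ext hyx
  rw [← this]
  exact hy

/-- The unperturbed operator `H₀`, restricted to the span of its eigenvectors. -/
def coreOp : Module.End ℂ S.core :=
  LinearMap.codRestrict S.core (S.op.toFun.comp (Submodule.inclusion S.core_le_domain))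
    S.op_mem_core

/-- The set of frequencies `(E k - E l) / (iħ)`, `k, l ∈ J`. -/
def frequencies (hbar : ℝ) : Set ℂ :=
  {z | ∃ k l : J, z = ((S.E k : ℂ) - (S.E l : ℂ)) / (Complex.I * (hbar : ℂ))}

/-- The component `V_z`, on the span of the eigenvectors, of a bounded operator `V`: the sum
of the operators `⟨e k, V e l⟩ |e k⟩⟨e l|` over the pairs `(k, l)` with `E k - E l = iħ z`.
(Given `l`, there is at most one such `k`, since the eigenvalues are simple.) -/
def component (hbar : ℝ) (V : H →L[ℂ] H) (z : ℂ) : Module.End ℂ S.core :=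
  S.coreBasis.constr ℂ fun l =>
    ∑ᶠ (k : J) (_ : (S.E k : ℂ) - (S.E l : ℂ) = Complex.I * (hbar : ℂ) * z),
      inner ℂ (S.e k) (V (S.e l)) • S.coreBasis k

/-- `V` is finite-band: only finitely many of the components `V_z`, for `z` a frequency,
are nonzero. -/
def FiniteBand (hbar : ℝ) (V : H →L[ℂ] H) : Prop :=
  {z : S.frequencies hbar | S.component hbar V z ≠ 0}.Finite

theorem component_coreBasis {hbar : ℝ} (hh : 0 < hbar) (V : H →L[ℂ] H) (k l : J) :
    S.component hbar V (((S.E k : ℂ) - (S.E l : ℂ)) / (Complex.I * (hbar : ℂ))) (S.coreBasis l) =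
      inner ℂ (S.e k) (V (S.e l)) • S.coreBasis k := by
  have h0 : Complex.I * (hbar : ℂ) ≠ 0 :=
    mul_ne_zero Complex.I_ne_zero (by exact_mod_cast hh.ne')
  rw [component, Module.Basis.constr_basis, mul_div_cancel₀ _ h0]
  rw [finsum_eq_single _ k]
  · simp
  · intro m hm
    have hne : ¬ ((S.E m : ℂ) - (S.E l : ℂ) = (S.E k : ℂ) - (S.E l : ℂ)) := fun h => by
      have h1 := sub_left_injective h
      exact hm (S.simple (by exact_mod_cast h1))
    simp only [hne, finsum_false]

theorem map_mem_core {hbar : ℝ} (hh : 0 < hbar) {V : H →L[ℂ] H} (hV : S.FiniteBand hbar V) :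
    ∀ x ∈ S.core, (V : H →ₗ[ℂ] H) x ∈ S.core := by
  have h0 : Complex.I * (hbar : ℂ) ≠ 0 :=
    mul_ne_zero Complex.I_ne_zero (by exact_mod_cast hh.ne')
  suffices h : S.core ≤ S.core.comap (V : H →ₗ[ℂ] H) from fun x hx => h hx
  rw [Submodule.span_le]
  rintro _ ⟨l, rfl⟩
  change V (S.e l) ∈ S.core
  let g : J → S.frequencies hbar := fun k =>
    ⟨((S.E k : ℂ) - (S.E l : ℂ)) / (Complex.I * (hbar : ℂ)), k, l, rfl⟩
  have hg : Function.Injective g := by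
    intro k k' hk
    have h1 := congrArg Subtype.val hk
    have h2 := (div_left_inj' h0).1 h1
    have h3 := sub_left_injective h2
    exact S.simple (by exact_mod_cast h3)
  have hfin : {k : J | inner ℂ (S.e k) (V (S.e l)) ≠ (0 : ℂ)}.Finite := by
    refine (hV.preimage hg.injOn).subset fun k hk hz => ?_
    have h1 := S.component_coreBasis hh V k l
    rw [show S.component hbar V (((S.E k : ℂ) - (S.E l : ℂ)) / (Complex.I * (hbar : ℂ))) = 0
      from hz, LinearMap.zero_apply] at h1
    exact (smul_ne_zero hk (S.coreBasis.ne_zero k)) h1.symm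
  have h1 := S.e.hasSum_repr (V (S.e l))
  have h2 : HasSum (fun k => S.e.repr (V (S.e l)) k • S.e k)
      (∑ k ∈ hfin.toFinset, S.e.repr (V (S.e l)) k • S.e k) := by
    refine hasSum_sum_of_ne_finset_zero fun k hk => ?_
    have : inner ℂ (S.e k) (V (S.e l)) = (0 : ℂ) := by simpa using hk
    rw [S.e.repr_apply_apply, this, zero_smul]
  rw [h1.unique h2]
  exact S.core.sum_mem fun k _ => S.core.smul_mem _ (Submodule.subset_span ⟨k, rfl⟩)

/-- A finite-band perturbation `V`, restricted to the span of the eigenvectors of `H₀`. -/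
def corePerturbation {hbar : ℝ} (hh : 0 < hbar) {V : H →L[ℂ] H} (hV : S.FiniteBand hbar V) :
    Module.End ℂ S.core :=
  LinearMap.restrict (V : H →ₗ[ℂ] H) (S.map_mem_core hh hV)

/-- The Lie algorithm: `W = W₁ μ + W₂ μ² + ⋯` and `N = N₁ μ + N₂ μ² + ⋯` are formal series in
the size `μ` of the perturbation, the `W_k` are symmetric operators, and the formal unitary operator
`C = exp (W / (iħ))` satisfies `C (H₀ + μ V) C⁻¹ = H₀ + N` with `[H₀, N] = 0`, at every order
in `μ`.  All operators are defined on the span of the eigenvectors of `H₀`, which they preserve. -/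
structure IsRayleighSchrodinger {hbar : ℝ} (hh : 0 < hbar) {V : H →L[ℂ] H}
    (hV : S.FiniteBand hbar V) (W N : PowerSeries (Module.End ℂ S.core)) : Prop where
  generator_zero : PowerSeries.coeff 0 W = 0
  generator_symmetric : ∀ k, (PowerSeries.coeff k W : Module.End ℂ S.core).IsSymmetric
  normal_zero : PowerSeries.coeff 0 N = 0
  conjugation :
    formalExp ((Complex.I * (hbar : ℂ))⁻¹ • W) *
        (PowerSeries.C S.coreOp + PowerSeries.X * PowerSeries.C (S.corePerturbation hh hV)) *
        formalExp (-((Complex.I * (hbar : ℂ))⁻¹ • W)) =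
      PowerSeries.C S.coreOp + N
  commute : ∀ k, S.coreOp * PowerSeries.coeff k N = PowerSeries.coeff k N * S.coreOp

/-- The term
`N^{z₁⋯z_k} (1/iħ)[V_{z₁}, (1/iħ)[V_{z₂}, … (1/iħ)[V_{z_{k-1}}, V_{z_k}] … ]]` of the expansion, where
`N^{z₁⋯z_k}` is minus the residue of `U^{z₁⋯z_k}`. -/
def expansionTerm (hbar : ℝ) (V : H →L[ℂ] H) (U : Mould (S.frequencies hbar)) {k : ℕ}
    (z : Fin k → S.frequencies hbar) : Module.End ℂ S.core :=
  (-laurentResidue (U (List.ofFn z))) •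
    nestedBracket hbar (List.ofFn fun i => S.component hbar V (z i))

end SimpleHamiltonian

end

noncomputable section

/-! ### Polar and regular Laurent series -/

/-! The coefficients of the normal form solve a mould equation, which the Birkhoff factors of `T`
solve explicitly. Words are read backwards throughout, so that recursions act on the head of a list:
with t, m, p the reversals of `T`, `U₋`, `U₊`, the decomposition reads t * m = p. Let ∇ be
multiplication by the weight φ(w) + |w| ε. It is a derivation of the convolution, and ∇t =
`dropHead` t characterizes t.

Let c(w) = -|w| Res m(w). The series ∇m + m * c is polar, because c cancels its constant term. Its
convolution by t on the left is ∇p - `dropHead` p + p * c, which is regular. As ℂ((ε)) is the direct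
sum of its polar and regular parts, induction on the length gives ∇m + m * c = 0 (`minus_equation`).
Two consequences follow: c vanishes on words with φ(w) ≠ 0 (`resonant`), and at ε = 0 the factor p
satisfies φ p + p * c = `dropHead` p (`plus_equation`). Replacing letters by the operators V_λ /
(iħ) turns these into an operator series commuting with H₀ and a formal conjugation of H₀ + μV to H₀
plus that series.

The simplicity of the spectrum makes the commutant of H₀ diagonal, hence commutative, so a normal
form is determined by its formal conjugacy class (`normalForm_unique`). Any N from the Lie algorithm
is therefore the one above.

It remains to pass from products of operators to iterated brackets. `T` is symmetral, hence so is
`U₋`, and its residue is alternal because a product of two polar series has no residue. For alternal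
coefficients the Dynkin–Specht–Wever identity replaces each product of k letters by 1/k times an
iterated bracket, and this 1/k cancels the length in c. Existence of the pair (W, N) is separate:
the homological equation is solved order by order with symmetric solutions. -/

theorem eq_zero_of_isPolarPart_of_isRegularPart {x : ℂ⸨X⸩} (h : IsPolarPart x)
    (h' : IsRegularPart x) : x = 0 := by
  ext n
  rcases lt_or_ge n 0 with hn | hn
  · exact h' n hn
  · exact h n hn

theorem isPolarPart_zero : IsPolarPart 0 := fun _ _ => rfl

theorem isRegularPart_zero : IsRegularPart 0 := fun _ _ => rfl

theorem isRegularPart_one : IsRegularPart 1 := fun n hn => by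
  rw [HahnSeries.coeff_one, if_neg hn.ne]

namespace IsPolarPart

variable {x y : ℂ⸨X⸩}

theorem add (hx : IsPolarPart x) (hy : IsPolarPart y) : IsPolarPart (x + y) := fun n hn => by
  rw [HahnSeries.coeff_add, hx n hn, hy n hn, add_zero]

theorem sub (hx : IsPolarPart x) (hy : IsPolarPart y) : IsPolarPart (x - y) := fun n hn => by
  rw [HahnSeries.coeff_sub, hx n hn, hy n hn, sub_zero]

theorem C_mul (c : ℂ) (hx : IsPolarPart x) : IsPolarPart (HahnSeries.C c * x) := fun n hn => by
  rw [HahnSeries.C_mul_eq_smul, HahnSeries.coeff_smul, hx n hn, smul_zero]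

/-- The product has degrees at most -2. The case n = -1 is what makes residues of `U₋` alternal. -/
theorem coeff_mul_eq_zero (hx : IsPolarPart x) (hy : IsPolarPart y) {n : ℤ} (hn : -1 ≤ n) :
    (x * y).coeff n = 0 := by
  rw [HahnSeries.coeff_mul]
  refine Finset.sum_eq_zero fun p hp => ?_
  have h := (Finset.mem_antidiagonal.1 hp).2.2
  rcases lt_or_ge p.1 0 with h1 | h1
  · rw [hy p.2 (by omega), mul_zero]
  · rw [hx p.1 h1, zero_mul]

theorem mul (hx : IsPolarPart x) (hy : IsPolarPart y) : IsPolarPart (x * y) := fun _ hn =>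
  hx.coeff_mul_eq_zero hy (by omega)

end IsPolarPart

namespace IsRegularPart

variable {x y : ℂ⸨X⸩}

theorem add (hx : IsRegularPart x) (hy : IsRegularPart y) : IsRegularPart (x + y) :=
  fun n hn => by rw [HahnSeries.coeff_add, hx n hn, hy n hn, add_zero]

theorem sub (hx : IsRegularPart x) (hy : IsRegularPart y) : IsRegularPart (x - y) :=
  fun n hn => by rw [HahnSeries.coeff_sub, hx n hn, hy n hn, sub_zero]

theorem mul (hx : IsRegularPart x) (hy : IsRegularPart y) : IsRegularPart (x * y) := fun n hn => by
  rw [HahnSeries.coeff_mul]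
  refine Finset.sum_eq_zero fun p hp => ?_
  have h := (Finset.mem_antidiagonal.1 hp).2.2
  rcases lt_or_ge p.1 0 with h1 | h1
  · rw [hx p.1 h1, zero_mul]
  · rw [hy p.2 (by omega), mul_zero]

end IsRegularPart

theorem isRegularPart_C (c : ℂ) : IsRegularPart (HahnSeries.C c) := fun n hn => by
  rw [HahnSeries.C_apply, HahnSeries.coeff_single_of_ne hn.ne]

/-- The polar part of a Laurent series. -/
def polarProj (x : ℂ⸨X⸩) : ℂ⸨X⸩ := HahnSeries.truncLT 0 x

theorem isPolarPart_polarProj (x : ℂ⸨X⸩) : IsPolarPart (polarProj x) := fun n hn => by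
  rw [polarProj, HahnSeries.coeff_truncLT, if_neg hn.not_gt]

theorem isRegularPart_sub_polarProj (x : ℂ⸨X⸩) : IsRegularPart (x - polarProj x) :=
  fun n hn => by
    rw [polarProj, HahnSeries.coeff_sub, HahnSeries.coeff_truncLT, if_pos hn, sub_self]

theorem coeff_laurentEps_mul (x : ℂ⸨X⸩) (n : ℤ) : (laurentEps * x).coeff n = x.coeff (n - 1) := by
  rw [laurentEps, HahnSeries.coeff_single_mul, one_mul]

theorem exists_coeff_eq_zero_of_lt (x : ℂ⸨X⸩) : ∃ m : ℤ, ∀ n < m, x.coeff n = 0 := by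
  by_cases hx : x = 0
  · exact ⟨0, fun n _ => by rw [hx]; rfl⟩
  · exact ⟨x.order, fun n hn => HahnSeries.coeff_eq_zero_of_lt_order hn⟩

theorem laurentEps_inv : laurentEps⁻¹ = HahnSeries.single (-1 : ℤ) (1 : ℂ) := by
  refine inv_eq_of_mul_eq_one_right ?_
  rw [laurentEps, HahnSeries.single_mul_single]
  simp

theorem algebraMap_eq_C (c : ℂ) : algebraMap ℂ ℂ⸨X⸩ c = HahnSeries.C c := by
  rw [HahnSeries.algebraMap_apply']
  simp

theorem IsPolarPart.hasValueAtInfinity {x : ℂ⸨X⸩} (hx : IsPolarPart x) :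
    HasValueAtInfinity (laurentEps * x) (laurentResidue x) := by
  obtain ⟨m, hm⟩ := exists_coeff_eq_zero_of_lt x
  -- The coefficient of ε⁻ⁱ in εx is that of ε⁻ⁱ⁻¹ in x. All coefficients of x below degree `m`
  -- vanish, so i ≤ |m| suffices.
  refine ⟨∑ i ∈ Finset.range (m.natAbs + 1), Polynomial.monomial i (x.coeff (-(i : ℤ) - 1)),
    ?_, ?_⟩
  · rw [map_sum]
    ext n
    rw [coeff_laurentEps_mul, HahnSeries.coeff_sum]
    have key (i : ℕ) : (Polynomial.aeval laurentEps⁻¹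
        (Polynomial.monomial i (x.coeff (-(i : ℤ) - 1)))).coeff n =
          if n = -(i : ℤ) then x.coeff (n - 1) else 0 := by
      rw [Polynomial.aeval_monomial, laurentEps_inv, HahnSeries.single_pow,
        algebraMap_eq_C, HahnSeries.C_mul_eq_smul, HahnSeries.coeff_smul,
        HahnSeries.coeff_single]
      simp only [one_pow, smul_eq_mul, nsmul_eq_mul, mul_neg, mul_one, mul_ite, mul_zero]
      split_ifs with h
      · rw [h]
      · rfl
    simp only [key]
    rcases lt_or_ge 0 n with hn | hn
    · rw [hx _ (by omega), Finset.sum_eq_zero]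
      exact fun _ _ => ite_self _
    · rcases lt_or_ge m.natAbs n.natAbs with h | h
      · rw [hm _ (by omega), Finset.sum_eq_zero]
        exact fun _ _ => ite_self _
      · rw [Finset.sum_eq_single_of_mem n.natAbs (by simp; omega)
          (fun i _ hi => if_neg (by omega)), if_pos (by omega)]
  · rw [Polynomial.eval_finsetSum, Finset.sum_eq_single_of_mem 0 (by simp)]
    · simp [laurentResidue]
    · intro i _ hi
      rw [Polynomial.eval_monomial, zero_pow hi, mul_zero]

/-! ### Existence and uniqueness of the Birkhoff decomposition -/

namespace Mould

variable {α : Type*}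

/-- Isolates the full prefix: the remaining terms involve `M` only on strictly shorter words, so the
Birkhoff factors can be treated by recursion on the length. -/
theorem mul_eq_add (M T : Mould α) (hT : T [] = 1) (w : List α) :
    M.mul T w = M w + ∑ i : Fin w.length, M (w.take i) * T (w.drop i) := by
  rw [mul, Finset.sum_range_succ, List.take_length, List.drop_length, hT, mul_one, add_comm,
    Finset.sum_range]

/-- The polar factor of the Birkhoff decomposition of `T`. -/
def birkhoffMinus (T : Mould α) : Mould α
  | [] => 1
  -- Only proper prefixes occur. Subtracting the polar part of their sum is the one choice that
  -- makes the product with `T` regular.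
  | a :: w => -polarProj (∑ i : Fin (a :: w).length,
      birkhoffMinus T ((a :: w).take i) * T ((a :: w).drop i))
termination_by w => w.length
decreasing_by
  have := i.2
  simp only [List.length_take, List.length_cons] at this ⊢
  omega

theorem isBirkhoffDecomposition_birkhoffMinus (T : Mould α) (hT : T [] = 1) :
    IsBirkhoffDecomposition T (T.birkhoffMinus.mul T) T.birkhoffMinus where
  plus_nil := by simp [mul, birkhoffMinus, hT]
  minus_nil := by rw [birkhoffMinus]
  minus_polar w := by
    cases w with
    | nil => rw [birkhoffMinus, one, sub_self]; exact isPolarPart_zero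
    | cons a w =>
      rw [birkhoffMinus, one, ← zero_sub, sub_zero]
      exact isPolarPart_zero.sub (isPolarPart_polarProj _)
  plus_regular w := by
    cases w with
    | nil => simpa [mul, birkhoffMinus, hT] using isRegularPart_one
    | cons a w =>
      rw [mul_eq_add _ _ hT, birkhoffMinus, neg_add_eq_sub]
      exact isRegularPart_sub_polarProj _
  mul_eq := rfl

end Mould

namespace IsBirkhoffDecomposition

variable {α : Type*} {T P U P' U' : Mould α}

theorem isPolarPart (h : IsBirkhoffDecomposition T P U) {w : List α} (hw : w ≠ []) :
    IsPolarPart (U w) := by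
  obtain ⟨a, w, rfl⟩ := List.exists_cons_of_ne_nil hw
  simpa [Mould.one] using h.minus_polar (a :: w)

theorem minus_unique (hT : T [] = 1) (h : IsBirkhoffDecomposition T P U)
    (h' : IsBirkhoffDecomposition T P' U') : U = U' := by
  suffices H : ∀ n : ℕ, ∀ w : List α, w.length = n → U w = U' w from funext fun w => H _ w rfl
  intro n
  induction n using Nat.strong_induction_on with
  | _ n ih =>
    intro w hw
    rcases eq_or_ne w [] with rfl | hne
    · rw [h.minus_nil, h'.minus_nil]
    refine sub_eq_zero.1 (eq_zero_of_isPolarPart_of_isRegularPart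
      ((h.isPolarPart hne).sub (h'.isPolarPart hne)) ?_)
    have h1 := congrFun h.mul_eq w
    have h2 := congrFun h'.mul_eq w
    rw [Mould.mul_eq_add _ _ hT] at h1 h2
    -- The contributions of proper prefixes agree by induction, so the difference of the polar
    -- factors is also a difference of regular ones.
    have h3 : U w - U' w = P w - P' w := by
      rw [← h1, ← h2, add_sub_add_comm, left_eq_add, sub_eq_zero]
      refine Finset.sum_congr rfl fun i _ => ?_
      rw [ih (w.take i).length (by have := i.2; simp; omega) _ rfl]
    rw [h3]
    exact (h.plus_regular w).sub (h'.plus_regular w)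

end IsBirkhoffDecomposition

theorem Mould.existsUnique_isBirkhoffDecomposition {α : Type*} (T : Mould α) (hT : T [] = 1) :
    ∃! U : Mould α × Mould α, IsBirkhoffDecomposition T U.1 U.2 := by
  refine ⟨(T.birkhoffMinus.mul T, T.birkhoffMinus),
    T.isBirkhoffDecomposition_birkhoffMinus hT, ?_⟩
  rintro ⟨P, U⟩ h
  have hU : U = T.birkhoffMinus :=
    h.minus_unique hT (T.isBirkhoffDecomposition_birkhoffMinus hT)
  subst hU
  exact Prod.ext h.mul_eq.symm rfl

/-! ### Sums over the splittings of a word -/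

section Splitting

variable {α R : Type*}

/-- The sum of `φ x y` over the splittings `w = x y` of a word. -/
def splitSum [AddCommMonoid R] : List α → (List α → List α → R) → R
  | [], φ => φ [] []
  | a :: w, φ => φ [] (a :: w) + splitSum w fun x y => φ (a :: x) y

@[simp]
theorem splitSum_nil [AddCommMonoid R] (φ : List α → List α → R) : splitSum [] φ = φ [] [] := rfl

theorem splitSum_cons [AddCommMonoid R] (a : α) (w : List α) (φ : List α → List α → R) :
    splitSum (a :: w) φ = φ [] (a :: w) + splitSum w fun x y => φ (a :: x) y := rfl

theorem splitSum_eq_sum [AddCommMonoid R] (w : List α) (φ : List α → List α → R) :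
    splitSum w φ = ∑ i ∈ Finset.range (w.length + 1), φ (w.take i) (w.drop i) := by
  induction w generalizing φ with
  | nil => simp
  | cons a w ih =>
    rw [splitSum_cons, ih, List.length_cons, Finset.sum_range_succ' _ (w.length + 1), add_comm]
    simp

theorem splitSum_congr [AddCommMonoid R] {w : List α} {φ ψ : List α → List α → R}
    (h : ∀ x y, x ++ y = w → φ x y = ψ x y) : splitSum w φ = splitSum w ψ := by
  rw [splitSum_eq_sum, splitSum_eq_sum]
  exact Finset.sum_congr rfl fun i _ => h _ _ (List.take_append_drop i w)

theorem splitSum_eq_zero [AddCommMonoid R] {w : List α} {φ : List α → List α → R}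
    (h : ∀ x y, x ++ y = w → φ x y = 0) : splitSum w φ = 0 := by
  rw [splitSum_eq_sum]
  exact Finset.sum_eq_zero fun i _ => h _ _ (List.take_append_drop i w)

theorem splitSum_add [AddCommMonoid R] (w : List α) (φ ψ : List α → List α → R) :
    (splitSum w fun x y => φ x y + ψ x y) = splitSum w φ + splitSum w ψ := by
  simp only [splitSum_eq_sum, Finset.sum_add_distrib]

theorem splitSum_sub [AddCommGroup R] (w : List α) (φ ψ : List α → List α → R) :
    (splitSum w fun x y => φ x y - ψ x y) = splitSum w φ - splitSum w ψ := by
  simp only [splitSum_eq_sum, Finset.sum_sub_distrib]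

theorem mul_splitSum [NonUnitalNonAssocSemiring R] (c : R) (w : List α)
    (φ : List α → List α → R) : c * splitSum w φ = splitSum w fun x y => c * φ x y := by
  simp only [splitSum_eq_sum, Finset.mul_sum]

theorem splitSum_mul [NonUnitalNonAssocSemiring R] (c : R) (w : List α)
    (φ : List α → List α → R) : splitSum w φ * c = splitSum w fun x y => φ x y * c := by
  simp only [splitSum_eq_sum, Finset.sum_mul]

theorem map_splitSum {S F : Type*} [AddCommMonoid R] [AddCommMonoid S] [FunLike F R S]
    [AddMonoidHomClass F R S] (f : F) (w : List α) (φ : List α → List α → R) :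
    f (splitSum w φ) = splitSum w fun x y => f (φ x y) := by
  simp only [splitSum_eq_sum, map_sum]

theorem splitSum_eq_left [AddCommMonoid R] {w : List α} {φ : List α → List α → R}
    (h : ∀ x y, x ++ y = w → x ≠ [] → φ x y = 0) : splitSum w φ = φ [] w := by
  cases w with
  | nil => rfl
  | cons a w =>
    rw [splitSum_cons, splitSum_eq_zero fun x y hxy => h (a :: x) y (by simp [hxy]) (by simp),
      add_zero]

theorem splitSum_append_singleton [AddCommMonoid R] (w : List α) (a : α)
    (φ : List α → List α → R) :
    splitSum (w ++ [a]) φ = (splitSum w fun x y => φ x (y ++ [a])) + φ (w ++ [a]) [] := by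
  induction w generalizing φ with
  | nil => simp [splitSum_cons]
  | cons b w ih => rw [List.cons_append, splitSum_cons, ih, splitSum_cons, add_assoc,
      List.cons_append]

theorem splitSum_reverse [AddCommMonoid R] (w : List α) (φ : List α → List α → R) :
    splitSum w.reverse φ = splitSum w fun x y => φ y.reverse x.reverse := by
  induction w generalizing φ with
  | nil => rfl
  | cons a w ih =>
    rw [List.reverse_cons, splitSum_append_singleton, ih, splitSum_cons, add_comm]
    simp

end Splitting

/-- The convolution product `(M * N)(w) = ∑ M x * N y` over the splittings `w = x y`. -/
def conv {α R : Type*} [Semiring R] (M N : List α → R) (w : List α) : R :=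
  splitSum w fun x y => M x * N y

section Convolution

variable {α R : Type*} [Semiring R]

@[simp]
theorem conv_nil (M N : List α → R) : conv M N [] = M [] * N [] := rfl

theorem conv_cons (M N : List α → R) (a : α) :
    (fun w => conv M N (a :: w)) =
      fun w => M [] * N (a :: w) + conv (fun x => M (a :: x)) N w := rfl

theorem conv_assoc (L M N : List α → R) : conv (conv L M) N = conv L (conv M N) := by
  funext w
  induction w generalizing L M with
  | nil => simp [mul_assoc]
  | cons a w ih =>
    have h1 := congrFun (conv_cons (conv L M) N a) w
    have h2 := congrFun (conv_cons L (conv M N) a) w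
    have h3 := congrFun (conv_cons M N a) w
    rw [h1, h2, h3, ← ih, conv_cons L M a, conv_nil, mul_add, mul_assoc, add_assoc]
    congr 1
    simp only [conv, add_mul, splitSum_add, mul_splitSum, mul_assoc]

end Convolution

/-- Reversal moves the recursion of `regularizedMould` from the last letter to the head of the list,
at the cost of exchanging the two factors. -/
theorem Mould.mul_reverse {α : Type*} (M N : Mould α) (w : List α) :
    M.mul N w.reverse = conv (fun x => N x.reverse) (fun x => M x.reverse) w := by
  rw [Mould.mul, ← splitSum_eq_sum w.reverse (fun x y => M x * N y), splitSum_reverse, conv]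
  simp only [mul_comm]

/-! ### Shuffles -/

/-- The sum of `M w` over the shuffles `w` of the words `u` and `v`. -/
def shuffleSum {α R : Type*} [AddCommMonoid R] : (List α → R) → List α → List α → R
  | M, [], v => M v
  | M, a :: u, [] => M (a :: u)
  | M, a :: u, b :: v =>
    shuffleSum (fun w => M (a :: w)) u (b :: v) + shuffleSum (fun w => M (b :: w)) (a :: u) v
termination_by _ u v => u.length + v.length

section Shuffle

variable {α R : Type*}

@[simp]
theorem shuffleSum_nil_left [AddCommMonoid R] (M : List α → R) (v : List α) :
    shuffleSum M [] v = M v := by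
  rw [shuffleSum]

@[simp]
theorem shuffleSum_nil_right [AddCommMonoid R] (M : List α → R) (u : List α) :
    shuffleSum M u [] = M u := by
  cases u <;> rw [shuffleSum]

theorem shuffleSum_cons_cons [AddCommMonoid R] (M : List α → R) (a b : α) (u v : List α) :
    shuffleSum M (a :: u) (b :: v) =
      shuffleSum (fun w => M (a :: w)) u (b :: v) +
        shuffleSum (fun w => M (b :: w)) (a :: u) v := by
  rw [shuffleSum]

/-- A linear property shared by all the values of `M` on words whose letters have been shuffled
from `u` and `v` holds for the shuffle sum. -/
theorem shuffleSum_induction [AddCommMonoid R] {p : R → Prop} (hp : ∀ x y, p x → p y → p (x + y))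
    (u v : List α) (M : List α → R)
    (h : ∀ w, w.Perm (u ++ v) → p (M w)) : p (shuffleSum M u v) := by
  match u, v with
  | [], v => simpa using h v (by simp)
  | a :: u, [] => simpa using h (a :: u) (by simp)
  | a :: u, b :: v =>
    rw [shuffleSum_cons_cons]
    refine hp _ _ (shuffleSum_induction hp u (b :: v) _ fun w hw => h _ ?_)
      (shuffleSum_induction hp (a :: u) v _ fun w hw => h _ ?_)
    · simpa using hw
    · exact (hw.cons b).trans List.perm_middle.symm
termination_by u.length + v.length

theorem shuffleSum_congr [AddCommMonoid R] (u v : List α) {M N : List α → R}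
    (h : ∀ w, w.Perm (u ++ v) → M w = N w) : shuffleSum M u v = shuffleSum N u v := by
  match u, v with
  | [], v => simpa using h v (by simp)
  | a :: u, [] => simpa using h (a :: u) (by simp)
  | a :: u, b :: v =>
    rw [shuffleSum_cons_cons, shuffleSum_cons_cons,
      shuffleSum_congr u (b :: v) fun w hw => h (a :: w) (by simpa using hw),
      shuffleSum_congr (a :: u) v fun w hw => h (b :: w)
        ((hw.cons b).trans List.perm_middle.symm)]
termination_by u.length + v.length

theorem shuffleSum_add [AddCommMonoid R] (M N : List α → R) (u v : List α) :
    shuffleSum (fun w => M w + N w) u v = shuffleSum M u v + shuffleSum N u v := by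
  match u, v with
  | [], v => simp
  | a :: u, [] => simp
  | a :: u, b :: v =>
    simp only [shuffleSum_cons_cons]
    rw [shuffleSum_add _ _ u (b :: v), shuffleSum_add _ _ (a :: u) v, add_add_add_comm]
termination_by u.length + v.length

theorem mul_shuffleSum [NonUnitalNonAssocSemiring R] (c : R) (M : List α → R) (u v : List α) :
    shuffleSum (fun w => c * M w) u v = c * shuffleSum M u v := by
  match u, v with
  | [], v => simp
  | a :: u, [] => simp
  | a :: u, b :: v =>
    simp only [shuffleSum_cons_cons]
    rw [mul_shuffleSum c _ u (b :: v), mul_shuffleSum c _ (a :: u) v, mul_add]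
termination_by u.length + v.length

theorem map_shuffleSum {S F : Type*} [AddCommMonoid R] [AddCommMonoid S] [FunLike F R S]
    [AddMonoidHomClass F R S] (f : F) (M : List α → R) (u v : List α) :
    f (shuffleSum M u v) = shuffleSum (fun w => f (M w)) u v := by
  match u, v with
  | [], v => simp
  | a :: u, [] => simp
  | a :: u, b :: v =>
    simp only [shuffleSum_cons_cons]
    rw [map_add, map_shuffleSum f _ u (b :: v), map_shuffleSum f _ (a :: u) v]
termination_by u.length + v.length

/-- The product of functions of two words: the sum over the splittings of both words. -/
def biconv [Semiring R] (F G : List α → List α → R) (u v : List α) : R :=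
  splitSum u fun u₁ u₂ => splitSum v fun v₁ v₂ => F u₁ v₁ * G u₂ v₂

/-- Shuffle sums are compatible with convolution. -/
theorem shuffleSum_conv [Semiring R] (M N : List α → R) (u v : List α) :
    shuffleSum (conv M N) u v = biconv (shuffleSum M) (shuffleSum N) u v := by
  match u, v with
  | [], v => simp [biconv, conv]
  | a :: u, [] => simp [biconv, conv]
  | a :: u, b :: v =>
    rw [shuffleSum_cons_cons, conv_cons, conv_cons, shuffleSum_add, shuffleSum_add,
      mul_shuffleSum, mul_shuffleSum, shuffleSum_conv _ _ u (b :: v),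
      shuffleSum_conv _ _ (a :: u) v]
    simp only [biconv, splitSum_cons, shuffleSum_nil_left, shuffleSum_cons_cons,
      shuffleSum_nil_right, splitSum_add, add_mul, mul_add]
    abel
termination_by u.length + v.length

end Shuffle

/-- `M` is symmetral: its shuffle sums are the products of its values. -/
def IsSymmetral {α R : Type*} [Semiring R] (M : List α → R) : Prop :=
  ∀ u v, shuffleSum M u v = M u * M v

/-- `M` is alternal: its shuffle sums over two nonempty words vanish. -/
def IsAlternal {α R : Type*} [Semiring R] (M : List α → R) : Prop :=
  ∀ u v, u ≠ [] → v ≠ [] → shuffleSum M u v = 0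

theorem biconv_mul {α R : Type*} [CommSemiring R] (M N : List α → R) (u v : List α) :
    biconv (fun u v => M u * M v) (fun u v => N u * N v) u v = conv M N u * conv M N v := by
  rw [biconv, conv, splitSum_mul]
  refine splitSum_congr fun x y _ => ?_
  rw [conv, mul_splitSum]
  exact splitSum_congr fun x' y' _ => mul_mul_mul_comm (M x) (M x') (N y) (N y')

theorem biconv_sub {α R : Type*} [CommRing R] (F G K : List α → List α → R) (u v : List α) :
    biconv F (fun u v => G u v - K u v) u v = biconv F G u v - biconv F K u v := by
  simp only [biconv, mul_sub, splitSum_sub]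

/-- If `T * U = P` with `T` symmetral, `U` polar and `P` regular, then `U` is symmetral. -/
theorem IsSymmetral.of_conv {α : Type*} {T U P : List α → ℂ⸨X⸩} (hT : IsSymmetral T)
    (hT0 : T [] = 1) (hU0 : U [] = 1) (hU : ∀ w, w ≠ [] → IsPolarPart (U w))
    (hP : ∀ w, IsRegularPart (P w)) (h : conv T U = P) : IsSymmetral U := by
  suffices H : ∀ n : ℕ, ∀ u v : List α, u.length + v.length = n →
      shuffleSum U u v - U u * U v = 0 from fun u v => sub_eq_zero.1 (H _ u v rfl)
  intro n
  induction n using Nat.strong_induction_on with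
  | _ n ih =>
    intro u v huv
    rcases eq_or_ne u [] with rfl | hu
    · simp [hU0]
    rcases eq_or_ne v [] with rfl | hv
    · simp [hU0]
    refine eq_zero_of_isPolarPart_of_isRegularPart
      (.sub (shuffleSum_induction (fun _ _ => IsPolarPart.add) u v U fun w hw => hU w ?_)
        ((hU u hu).mul (hU v hv))) ?_
    · rintro rfl
      simpa [hu] using hw.symm.eq_nil
    -- The failure of `U` to be symmetral, multiplied by the symmetral `T`, is the same failure for
    -- `P`, which is regular.
    have key : biconv (fun u v => T u * T v) (fun u v => shuffleSum U u v - U u * U v) u v =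
        shuffleSum P u v - P u * P v := by
      rw [biconv_sub, biconv_mul, ← h, shuffleSum_conv]
      congr 3
      funext u v
      exact (hT u v).symm
    have hlen {x y w : List α} (hxy : x ++ y = w) : x.length + y.length = w.length := by
      rw [← hxy, List.length_append]
    have hpos {x : List α} (hx : x ≠ []) : 0 < x.length := List.length_pos_iff.2 hx
    -- By induction the defect vanishes on shorter pairs, so only the splitting with both left parts
    -- empty survives; there `T` contributes 1.
    rw [biconv, splitSum_eq_left, splitSum_eq_left] at key
    · rw [hT0, one_mul, one_mul] at key
      rw [key]
      exact (shuffleSum_induction (fun _ _ => IsRegularPart.add) u v P fun w _ => hP w).sub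
        ((hP u).mul (hP v))
    · intro x y hxy hx
      have := hlen hxy
      have := hpos hx
      rw [ih (u.length + y.length) (by omega) u y rfl, mul_zero]
    · intro x y hxy hx
      refine splitSum_eq_zero fun x' y' hxy' => ?_
      have := hlen hxy
      have := hlen hxy'
      have := hpos hx
      rw [ih (y.length + y'.length) (by omega) y y' rfl, mul_zero]

/-! ### The regularized mould and its Birkhoff decomposition -/

section MouldEquations

variable {α : Type*} (φ : α → ℂ)

/-- The factor `φ(n₁) + ⋯ + φ(n_r) + r ε` attached to a word. -/
def wordWeight (w : List α) : ℂ⸨X⸩ :=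
  HahnSeries.C (w.map φ).sum + (w.length : ℂ⸨X⸩) * laurentEps

theorem wordWeight_nil : wordWeight φ [] = 0 := by simp [wordWeight]

/-- Additivity makes multiplication by the weight a derivation of the convolution. Together with
invariance under permutation it also lets the weight pass through shuffle sums. -/
theorem wordWeight_append (x y : List α) :
    wordWeight φ (x ++ y) = wordWeight φ x + wordWeight φ y := by
  simp only [wordWeight, List.map_append, List.sum_append, map_add, List.length_append,
    Nat.cast_add]
  ring

theorem wordWeight_perm {x y : List α} (h : x.Perm y) : wordWeight φ x = wordWeight φ y := by
  rw [wordWeight, wordWeight, (h.map φ).sum_eq, h.length_eq]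

theorem coeff_natCast_mul (n : ℕ) (x : ℂ⸨X⸩) (i : ℤ) :
    ((n : ℂ⸨X⸩) * x).coeff i = n * x.coeff i := by
  rw [← nsmul_eq_mul, HahnSeries.coeff_nsmul, Pi.smul_apply, nsmul_eq_mul]

theorem coeff_wordWeight_mul (w : List α) (x : ℂ⸨X⸩) (n : ℤ) :
    (wordWeight φ w * x).coeff n =
      (w.map φ).sum * x.coeff n + w.length * x.coeff (n - 1) := by
  rw [wordWeight, add_mul, HahnSeries.coeff_add, HahnSeries.C_mul_eq_smul, HahnSeries.coeff_smul,
    mul_assoc, coeff_natCast_mul, coeff_laurentEps_mul, smul_eq_mul]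

/-- The coefficient of ε is the length of the word. This is how ε regularizes the zero denominators
of resonant words. -/
theorem wordWeight_ne_zero {w : List α} (hw : w ≠ []) : wordWeight φ w ≠ 0 := by
  intro h
  have h1 := coeff_wordWeight_mul φ w 1 1
  rw [h, zero_mul, HahnSeries.coeff_zero, HahnSeries.coeff_one, HahnSeries.coeff_one] at h1
  simp only [one_ne_zero, if_false, mul_zero, zero_add, sub_self, if_true, mul_one] at h1
  exact hw (List.length_eq_zero_iff.1 (by exact_mod_cast h1.symm))

theorem regularizedMould_nil : regularizedMould φ [] = 1 := by simp [regularizedMould]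

theorem regularizedMould_append_singleton (w : List α) (a : α) :
    regularizedMould φ (w ++ [a]) = regularizedMould φ w * (wordWeight φ (w ++ [a]))⁻¹ := by
  rw [regularizedMould, List.length_append, List.length_singleton, Finset.prod_range_succ,
    regularizedMould]
  congr 1
  · refine Finset.prod_congr rfl fun j hj => ?_
    rw [List.take_append_of_le_length (by simpa using hj)]
  · rw [wordWeight, List.take_of_length_le (by simp), List.length_append, List.length_singleton]

/-- The first-order equation ∇t = `dropHead` t: the weight of the whole word is the last factor of
the product. -/
theorem wordWeight_mul_regularizedMould (a : α) (w : List α) :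
    wordWeight φ (a :: w) * regularizedMould φ (a :: w).reverse =
      regularizedMould φ w.reverse := by
  rw [List.reverse_cons, regularizedMould_append_singleton, ← List.reverse_cons,
    wordWeight_perm φ (List.reverse_perm _), mul_left_comm,
    mul_inv_cancel₀ (wordWeight_ne_zero φ (by simp)), mul_one]

/-- Multiply by the weight of uv. On a shuffle it strips the first letter; on the product t(u) t(v)
it splits as a sum of two weights, each stripping the first letter of one word. Both sides thus obey
the same recursion, and the weight is invertible. -/
theorem isSymmetral_regularizedMould :
    IsSymmetral fun w : List α => regularizedMould φ w.reverse
  | [], v => by simp [regularizedMould_nil]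
  | a :: u, [] => by simp [regularizedMould_nil]
  | a :: u, b :: v => by
    have h0 : wordWeight φ ((a :: u) ++ (b :: v)) ≠ 0 := wordWeight_ne_zero φ (by simp)
    refine mul_left_cancel₀ h0 ?_
    rw [shuffleSum_cons_cons, mul_add, ← mul_shuffleSum, ← mul_shuffleSum,
      shuffleSum_congr u (b :: v) (N := fun w => regularizedMould φ w.reverse),
      shuffleSum_congr (a :: u) v (N := fun w => regularizedMould φ w.reverse),
      isSymmetral_regularizedMould u (b :: v), isSymmetral_regularizedMould (a :: u) v,
      wordWeight_append, add_mul, mul_left_comm (wordWeight φ (b :: v)), ← mul_assoc,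
      wordWeight_mul_regularizedMould, wordWeight_mul_regularizedMould]
    · intro w hw
      rw [← wordWeight_mul_regularizedMould φ b w,
        wordWeight_perm φ ((hw.cons b).trans List.perm_middle.symm)]
    · intro w hw
      rw [← wordWeight_mul_regularizedMould φ a w, List.cons_append,
        wordWeight_perm φ (hw.cons a)]
termination_by u v => u.length + v.length

theorem wordWeight_mul_conv (M N : List α → ℂ⸨X⸩) (w : List α) :
    wordWeight φ w * conv M N w =
      conv (fun x => wordWeight φ x * M x) N w + conv M (fun x => wordWeight φ x * N x) w := by
  rw [conv, conv, conv, mul_splitSum, ← splitSum_add]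
  refine splitSum_congr fun x y h => ?_
  rw [← h, wordWeight_append]
  ring

end MouldEquations

/-- The convolution of `M` with the indicator of the words of length one. -/
def dropHead {α R : Type*} [Zero R] (M : List α → R) : List α → R
  | [] => 0
  | _ :: w => M w

theorem conv_dropHead {α R : Type*} [Semiring R] (M N : List α → R) :
    conv (dropHead M) N = dropHead (conv M N) := by
  funext w
  cases w with
  | nil => simp [dropHead]
  | cons a w =>
    rw [congrFun (conv_cons (dropHead M) N a) w]
    simp [dropHead]

theorem conv_add_right {α R : Type*} [Semiring R] (L M N : List α → R) (w : List α) :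
    conv L (fun x => M x + N x) w = conv L M w + conv L N w := by
  simp only [conv, mul_add, splitSum_add]

/-! ### Mould equations satisfied by the two Birkhoff factors -/

namespace IsBirkhoffDecomposition

variable {α : Type*} {T P U : Mould α}

/-- The normal form coefficients attached to the polar factor `U`, on reversed words. -/
def _root_.normalCoeff (U : Mould α) (w : List α) : ℂ := -laurentResidue (U w.reverse)

/-- The normal form coefficients multiplied by the lengths of the words. -/
def _root_.scaledNormalCoeff (U : Mould α) (w : List α) : ℂ := w.length * normalCoeff U w

theorem conv_reverse (h : IsBirkhoffDecomposition T P U) :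
    (conv (fun w => T w.reverse) fun w => U w.reverse) = fun w => P w.reverse := by
  funext w
  rw [← Mould.mul_reverse, h.mul_eq]

theorem isSymmetral_minus (h : IsBirkhoffDecomposition T P U) (hT0 : T [] = 1)
    (hT : IsSymmetral fun w => T w.reverse) : IsSymmetral fun w => U w.reverse :=
  hT.of_conv hT0 h.minus_nil (fun _ hw => h.isPolarPart (by simpa using hw))
    (fun w => h.plus_regular w.reverse) h.conv_reverse

theorem isAlternal_normalCoeff (h : IsBirkhoffDecomposition T P U) (hT0 : T [] = 1)
    (hT : IsSymmetral fun w => T w.reverse) : IsAlternal (normalCoeff U) := by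
  intro u v hu hv
  have key : shuffleSum (normalCoeff U) u v =
      -laurentResidue (shuffleSum (fun w => U w.reverse) u v) :=
    (map_shuffleSum (-(HahnSeries.coeff.addMonoidHom (-1) : ℂ⸨X⸩ →+ ℂ))
      (fun w => U w.reverse) u v).symm
  rw [key, h.isSymmetral_minus hT0 hT, laurentResidue, IsPolarPart.coeff_mul_eq_zero
    (h.isPolarPart (by simpa using hu)) (h.isPolarPart (by simpa using hv)) le_rfl, neg_zero]

variable {φ : α → ℂ}

/-- The left side is polar: in degree 0 the weight contributes |w| times the residue of m(w), which
is -c(w), while the only non-polar term of m * c is c(w). Convolving with t gives ∇p - `dropHead` p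
+ p * c, which is regular, and by induction this convolution reduces to the left side itself at w.
-/
theorem minus_equation (h : IsBirkhoffDecomposition (regularizedMould φ) P U) (w : List α) :
    wordWeight φ w * U w.reverse +
      conv (fun w => U w.reverse) (fun w => HahnSeries.C (scaledNormalCoeff U w)) w = 0 := by
  induction hn : w.length using Nat.strong_induction_on generalizing w with
  | _ n ih =>
    subst hn
    set t : List α → ℂ⸨X⸩ := fun w => regularizedMould φ w.reverse with ht
    set m : List α → ℂ⸨X⸩ := fun w => U w.reverse with hm
    set p : List α → ℂ⸨X⸩ := fun w => P w.reverse with hp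
    set c : List α → ℂ⸨X⸩ := fun w => HahnSeries.C (scaledNormalCoeff U w) with hc
    have hc0 : c [] = 0 := by simp [hc, scaledNormalCoeff]
    have hm0 : m [] = 1 := h.minus_nil
    have hcv : conv t m = p := h.conv_reverse
    have ht0 : t [] = 1 := regularizedMould_nil φ
    have hdt : (fun x => wordWeight φ x * t x) = dropHead t := by
      funext x
      cases x with
      | nil => simp [dropHead, wordWeight_nil]
      | cons a x => exact wordWeight_mul_regularizedMould φ a x
    have hpr (x : List α) : IsRegularPart (p x) := h.plus_regular _
    have hmp {x : List α} (hx : x ≠ []) : IsPolarPart (m x) := h.isPolarPart (by simpa using hx)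
    have hconv_reg (x : List α) : IsRegularPart (conv p c x) := by
      rw [conv, splitSum_eq_sum]
      refine Finset.sum_induction _ IsRegularPart (fun _ _ => IsRegularPart.add)
        isRegularPart_zero fun i _ => (hpr _).mul (isRegularPart_C _)
    rcases eq_or_ne w [] with rfl | hw
    · simp [wordWeight_nil, hc0]
    refine eq_zero_of_isPolarPart_of_isRegularPart ?_ ?_
    · intro n hn
      have h1 : conv m c w = c w + (conv m c w - c w) := by ring
      have h2 : IsPolarPart (conv m c w - c w) := by
        obtain ⟨a, w, rfl⟩ := List.exists_cons_of_ne_nil hw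
        rw [conv, splitSum_cons, hm0, one_mul, add_sub_cancel_left, splitSum_eq_sum]
        refine Finset.sum_induction _ IsPolarPart (fun _ _ => IsPolarPart.add)
          isPolarPart_zero fun i _ => ?_
        rw [mul_comm]
        exact (hmp (by simp)).C_mul _
      rw [h1, HahnSeries.coeff_add, HahnSeries.coeff_add, h2 n hn, coeff_wordWeight_mul,
        hmp hw n hn, mul_zero, zero_add, add_zero]
      simp only [hc, HahnSeries.C_apply, HahnSeries.coeff_single]
      split_ifs with h0
      · subst h0
        simp [scaledNormalCoeff, normalCoeff, laurentResidue]
      · rw [hmp hw (n - 1) (by omega), mul_zero, add_zero]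
    · have key : conv t (fun x => wordWeight φ x * m x + conv m c x) w =
          wordWeight φ w * p w - dropHead p w + conv p c w := by
        rw [conv_add_right, ← conv_assoc, hcv, ← hcv, wordWeight_mul_conv, hdt, conv_dropHead]
        ring
      rw [conv, splitSum_eq_left, ht0, one_mul] at key
      · rw [key]
        refine (IsRegularPart.sub ?_ ?_).add (hconv_reg w)
        · intro n hn
          rw [coeff_wordWeight_mul, hpr w n hn, hpr w _ (by omega), mul_zero, mul_zero, add_zero]
        · cases w with
          | nil => exact isRegularPart_zero
          | cons a w => exact hpr w
      · intro x y hxy hx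
        have h1 : x.length + y.length = w.length := by rw [← hxy, List.length_append]
        have h2 : 0 < x.length := List.length_pos_iff.2 hx
        rw [ih y.length (by omega) y rfl, mul_zero]

/-- The polar factor and the normal form coefficients are supported by the resonant words. -/
theorem resonant (h : IsBirkhoffDecomposition (regularizedMould φ) P U) (w : List α)
    (hw : (w.map φ).sum ≠ 0) : U w.reverse = 0 ∧ scaledNormalCoeff U w = 0 := by
  induction hn : w.length using Nat.strong_induction_on generalizing w with
  | _ n ih =>
    subst hn
    have hne : w ≠ [] := by
      rintro rfl
      exact hw rfl
    suffices H : U w.reverse = 0 by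
      refine ⟨H, ?_⟩
      simp [scaledNormalCoeff, normalCoeff, H, laurentResidue]
    have hpol : IsPolarPart (U w.reverse) := h.isPolarPart (by simpa using hne)
    have key := h.minus_equation w
    -- In a splitting of a non-resonant word one part is non-resonant, so its factor vanishes by
    -- induction; only the constant c(w) is left of m * c.
    rw [conv, splitSum_eq_left] at key
    -- At the lowest degree of `U w.reverse`, which is negative, neither the constant c(w) nor the
    -- ε-term of the weight contributes. The frequency sum times the leading coefficient would then
    -- be 0.
    · by_contra hU
      have h1 : (U w.reverse).order < 0 := by
        by_contra h0
        exact mt HahnSeries.coeff_order_eq_zero.1 hU (hpol _ (not_lt.1 h0))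
      have h2 := congrArg (fun x => HahnSeries.coeff x (U w.reverse).order) key
      simp only [HahnSeries.coeff_add, HahnSeries.coeff_zero] at h2
      rw [coeff_wordWeight_mul, HahnSeries.coeff_eq_zero_of_lt_order
        (i := (U w.reverse).order - 1) (by omega), mul_zero, add_zero, List.reverse_nil,
        h.minus_nil, one_mul, HahnSeries.C_apply, HahnSeries.coeff_single_of_ne h1.ne,
        add_zero] at h2
      exact mul_ne_zero hw (mt HahnSeries.coeff_order_eq_zero.1 hU) h2
    · intro x y hxy hx
      have h1 : x.length + y.length = w.length := by rw [← hxy, List.length_append]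
      rcases eq_or_ne y [] with rfl | hy
      · simp [scaledNormalCoeff]
      have h2 : 0 < x.length := List.length_pos_iff.2 hx
      have h3 : 0 < y.length := List.length_pos_iff.2 hy
      by_cases hxs : (x.map φ).sum = 0
      · have hys : (y.map φ).sum ≠ 0 := by
          rw [← hxy, List.map_append, List.sum_append, hxs, zero_add] at hw
          exact hw
        rw [(ih y.length (by omega) y hys rfl).2, map_zero, mul_zero]
      · rw [(ih x.length (by omega) x hxs rfl).1, zero_mul]

/-- The value at `ε = 0` of the regular factor conjugates to the normal form. -/
theorem plus_equation (h : IsBirkhoffDecomposition (regularizedMould φ) P U) (w : List α) :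
    (w.map φ).sum * (P w.reverse).coeff 0 +
        conv (fun w => (P w.reverse).coeff 0) (scaledNormalCoeff U) w =
      dropHead (fun w => (P w.reverse).coeff 0) w := by
  set t : List α → ℂ⸨X⸩ := fun w => regularizedMould φ w.reverse with ht
  set m : List α → ℂ⸨X⸩ := fun w => U w.reverse with hm
  set p : List α → ℂ⸨X⸩ := fun w => P w.reverse with hp
  set c : List α → ℂ⸨X⸩ := fun w => HahnSeries.C (scaledNormalCoeff U w) with hc
  have hcv : conv t m = p := h.conv_reverse
  have hdt : (fun x => wordWeight φ x * t x) = dropHead t := by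
    funext x
    cases x with
    | nil => simp [dropHead, wordWeight_nil]
    | cons a x => exact wordWeight_mul_regularizedMould φ a x
  have hZ : (fun x => wordWeight φ x * m x + conv m c x) = fun _ => 0 :=
    funext h.minus_equation
  have key : conv t (fun x => wordWeight φ x * m x + conv m c x) w =
      wordWeight φ w * p w - dropHead p w + conv p c w := by
    rw [conv_add_right, ← conv_assoc, hcv, ← hcv, wordWeight_mul_conv, hdt, conv_dropHead]
    ring
  -- With ∇m + m * c = 0 the identity becomes ∇p + p * c = `dropHead` p. In degree 0 the term |w| ε
  -- p disappears because p is regular.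
  rw [hZ, conv, splitSum_eq_zero fun x y _ => mul_zero _] at key
  have h2 := congrArg (fun x => HahnSeries.coeff x 0) key
  simp only [HahnSeries.coeff_add, HahnSeries.coeff_sub, HahnSeries.coeff_zero] at h2
  rw [coeff_wordWeight_mul, h.plus_regular _ _ (by norm_num : (0 : ℤ) - 1 < 0), mul_zero,
    add_zero] at h2
  have h3 : (conv p c w).coeff 0 =
      conv (fun w => (P w.reverse).coeff 0) (scaledNormalCoeff U) w := by
    refine (map_splitSum (HahnSeries.coeff.addMonoidHom 0 : ℂ⸨X⸩ →+ ℂ) w _).trans ?_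
    refine splitSum_congr fun x y _ => ?_
    change (p x * c y).coeff 0 = _
    rw [mul_comm, HahnSeries.C_mul_eq_smul, HahnSeries.coeff_smul, smul_eq_mul, mul_comm]
  have h4 : (dropHead p w).coeff 0 = dropHead (fun w => (P w.reverse).coeff 0) w := by
    cases w <;> rfl
  rw [h3, h4] at h2
  linear_combination -h2

end IsBirkhoffDecomposition

/-! ### Sums over the words of given length -/

/-- The sum of `g w` over the words `w` of length `k` with letters in `F`. -/
def wordSum {α R : Type*} [AddCommMonoid R] (F : Finset α) (k : ℕ) (g : List α → R) : R :=
  ∑ z ∈ Fintype.piFinset fun _ : Fin k => F, g (List.ofFn z)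

section WordSum

variable {α R : Type*} (F : Finset α)

section AddCommMonoid

variable [AddCommMonoid R]

@[simp]
theorem wordSum_zero (g : List α → R) : wordSum F 0 g = g [] := by
  simp [wordSum]

theorem wordSum_succ (k : ℕ) (g : List α → R) :
    wordSum F (k + 1) g = ∑ a ∈ F, wordSum F k fun w => g (a :: w) := by
  simp only [wordSum]
  rw [← Finset.sum_product']
  refine Finset.sum_nbij' (fun z => (z 0, Fin.tail z)) (fun q => Fin.cons q.1 q.2) ?_ ?_ ?_ ?_ ?_
  · intro z hz
    rw [Fintype.mem_piFinset] at hz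
    rw [Finset.mem_product, Fintype.mem_piFinset]
    exact ⟨hz 0, fun i => hz i.succ⟩
  · rintro ⟨a, z⟩ hz
    rw [Finset.mem_product, Fintype.mem_piFinset] at hz
    rw [Fintype.mem_piFinset]
    exact Fin.cases hz.1 hz.2
  · intro z _
    exact Fin.cons_self_tail z
  · rintro ⟨a, z⟩ _
    simp
  · intro z _
    rw [List.ofFn_succ]
    rfl

theorem wordSum_congr {k : ℕ} {g g' : List α → R} (h : ∀ w, w.length = k → g w = g' w) :
    wordSum F k g = wordSum F k g' :=
  Finset.sum_congr rfl fun _ _ => h _ List.length_ofFn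

theorem wordSum_eq_zero {k : ℕ} {g : List α → R} (h : ∀ w, w.length = k → g w = 0) :
    wordSum F k g = 0 :=
  Finset.sum_eq_zero fun _ _ => h _ List.length_ofFn

theorem wordSum_add (k : ℕ) (g g' : List α → R) :
    (wordSum F k fun w => g w + g' w) = wordSum F k g + wordSum F k g' :=
  Finset.sum_add_distrib

theorem map_wordSum {S G : Type*} [AddCommMonoid S] [FunLike G R S] [AddMonoidHomClass G R S]
    (f : G) (k : ℕ) (g : List α → R) : f (wordSum F k g) = wordSum F k fun w => f (g w) :=
  map_sum f _ _

theorem sum_wordSum {ι : Type*} (s : Finset ι) (k : ℕ) (g : ι → List α → R) :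
    ∑ i ∈ s, wordSum F k (g i) = wordSum F k fun w => ∑ i ∈ s, g i w :=
  Finset.sum_comm

theorem wordSum_reverse (k : ℕ) (g : List α → R) :
    (wordSum F k fun w => g w.reverse) = wordSum F k g := by
  refine Finset.sum_equiv (Equiv.arrowCongr Fin.revPerm (Equiv.refl α)) (fun z => ?_) fun z _ => ?_
  · rw [Fintype.mem_piFinset, Fintype.mem_piFinset]
    exact ⟨fun h i => h _, fun h i => by simpa using h i.rev⟩
  · refine congrArg g (List.ext_getElem (by simp) fun i h _ => ?_)
    have hi : i < k := by simpa using h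
    simp [List.getElem_reverse, Equiv.arrowCongr, Fin.rev]
    congr 1
    ext
    simp
    omega

/-- A double sum over the splittings of the words of length `k` is a sum over pairs of words. -/
theorem wordSum_splitSum (k : ℕ) (φ : List α → List α → R) :
    (wordSum F k fun w => splitSum w φ) = ∑ p ∈ Finset.HasAntidiagonal.antidiagonal k,
      wordSum F p.1 fun x => wordSum F p.2 fun y => φ x y := by
  induction k generalizing φ with
  | zero => simp
  | succ k ih =>
    rw [Finset.Nat.sum_antidiagonal_succ, wordSum_succ, wordSum_zero]
    simp only [splitSum_cons, wordSum_add, Finset.sum_add_distrib, ih]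
    rw [wordSum_succ, Finset.sum_comm]
    simp only [wordSum_succ F (_ : ℕ) (fun x => wordSum F _ (φ x))]

end AddCommMonoid

theorem mul_wordSum [NonUnitalNonAssocSemiring R] (c : R) (k : ℕ) (g : List α → R) :
    c * wordSum F k g = wordSum F k fun w => c * g w :=
  Finset.mul_sum _ _ _

theorem wordSum_mul [NonUnitalNonAssocSemiring R] (c : R) (k : ℕ) (g : List α → R) :
    wordSum F k g * c = wordSum F k fun w => g w * c :=
  Finset.sum_mul _ _ _

theorem smul_wordSum {S : Type*} [AddCommMonoid R] [DistribSMul S R] (c : S) (k : ℕ)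
    (g : List α → R) : c • wordSum F k g = wordSum F k fun w => c • g w :=
  Finset.smul_sum

end WordSum

/-! ### Contraction of scalar moulds with operators -/

section Contraction

variable {α A : Type*} [Ring A]

/-- The product of the letters `f a` of a word, in reversed order. -/
def revProd (f : α → A) (w : List α) : A := (w.reverse.map f).prod

@[simp]
theorem revProd_nil (f : α → A) : revProd f [] = 1 := by simp [revProd]

theorem revProd_cons (f : α → A) (a : α) (w : List α) :
    revProd f (a :: w) = revProd f w * f a := by simp [revProd]

theorem revProd_append (f : α → A) (x y : List α) :
    revProd f (x ++ y) = revProd f y * revProd f x := by simp [revProd]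

theorem commute_revProd {f : α → A} {b : A} (h : ∀ a, Commute (f a) b) (w : List α) :
    Commute (revProd f w) b := by
  induction w with
  | nil => rw [revProd_nil]; exact Commute.one_left b
  | cons a w ih => rw [revProd_cons]; exact ih.mul_left (h a)

variable [Algebra ℂ A] (F : Finset α) (f : α → A)

/-- The formal series `∑ M w • f w` over the words `w` with letters in `F`, graded by length. -/
def contract (M : List α → ℂ) : PowerSeries A :=
  PowerSeries.mk fun k => wordSum F k fun w => M w • revProd f w

theorem coeff_contract (M : List α → ℂ) (k : ℕ) :
    PowerSeries.coeff k (contract F f M) = wordSum F k fun w => M w • revProd f w :=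
  PowerSeries.coeff_mk _ _

theorem contract_add (M N : List α → ℂ) :
    contract F f (fun w => M w + N w) = contract F f M + contract F f N := by
  ext k
  simp only [map_add, coeff_contract, add_smul, wordSum_add]

/-- The factors are exchanged because `revProd` is an antihomomorphism for concatenation. -/
theorem contract_conv (M N : List α → ℂ) :
    contract F f (conv M N) = contract F f N * contract F f M := by
  ext k
  have h (w : List α) : conv M N w • revProd f w =
      splitSum w fun x y => (M x * N y) • (revProd f y * revProd f x) := by
    rw [conv, ← LinearMap.toSpanSingleton_apply, map_splitSum]
    refine splitSum_congr fun x y hxy => ?_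
    rw [LinearMap.toSpanSingleton_apply, ← hxy, revProd_append]
  rw [coeff_contract, PowerSeries.coeff_mul, wordSum_congr F fun w _ => h w, wordSum_splitSum,
    ← Finset.Nat.sum_antidiagonal_swap]
  refine Finset.sum_congr rfl fun p _ => ?_
  rw [coeff_contract, coeff_contract, mul_wordSum]
  refine wordSum_congr F fun x _ => ?_
  rw [wordSum_mul]
  refine wordSum_congr F fun y _ => ?_
  rw [smul_mul_smul_comm, mul_comm]

/-- In `revProd` the head of the word is the rightmost factor, so restoring a dropped head
multiplies on the right by the sum of the letters and raises the order by one. -/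
theorem contract_dropHead (M : List α → ℂ) :
    contract F f (dropHead M) =
      contract F f M * PowerSeries.C (∑ a ∈ F, f a) * PowerSeries.X := by
  ext k
  cases k with
  | zero => simp [coeff_contract, dropHead]
  | succ k =>
    rw [PowerSeries.coeff_succ_mul_X, PowerSeries.coeff_mul_C, coeff_contract, coeff_contract,
      wordSum_succ, Finset.mul_sum]
    refine Finset.sum_congr rfl fun a _ => ?_
    rw [wordSum_mul]
    refine wordSum_congr F fun w _ => ?_
    rw [dropHead, revProd_cons, smul_mul_assoc]

theorem bracket_revProd {h : A} {φ : α → ℂ} (hf : ∀ a, h * f a - f a * h = φ a • f a)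
    (w : List α) : h * revProd f w - revProd f w * h = (w.map φ).sum • revProd f w := by
  induction w with
  | nil => simp
  | cons a w ih =>
    rw [revProd_cons, List.map_cons, List.sum_cons, add_smul, ← mul_smul_comm, ← hf a,
      ← smul_mul_assoc _ (revProd f w), ← ih]
    noncomm_ring

/-- The letters are eigenvectors of the derivation [h, ·], so a product of letters is one too, with
the sum of the eigenvalues. -/
theorem bracket_contract {h : A} {φ : α → ℂ} (hf : ∀ a, h * f a - f a * h = φ a • f a)
    (M : List α → ℂ) :
    PowerSeries.C h * contract F f M - contract F f M * PowerSeries.C h =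
      contract F f fun w => (w.map φ).sum * M w := by
  ext k
  rw [map_sub, PowerSeries.coeff_C_mul, PowerSeries.coeff_mul_C, coeff_contract, coeff_contract,
    mul_wordSum, wordSum_mul]
  refine (Finset.sum_sub_distrib _ _).symm.trans (Finset.sum_congr rfl fun z _ => ?_)
  beta_reduce
  rw [mul_smul_comm, smul_mul_assoc, ← smul_sub, bracket_revProd f hf, smul_smul, mul_comm]

end Contraction

/-! ### The Dynkin–Specht–Wever identity for alternal coefficients -/

section Dynkin

variable {α A : Type*} [Ring A] [Algebra ℂ A] (F : Finset α)

/-- Expanding the product marks each letter as an l or an s. Since these commute, the result depends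
only on the subword u of l-letters and the subword v of s-letters, and the words that produce (u, v)
are their shuffles. -/
theorem wordSum_smul_revProd_add {l s : α → A} (hls : ∀ a b, Commute (l a) (s b))
    (k : ℕ) (M : List α → ℂ) :
    (wordSum F k fun w => M w • revProd (fun a => l a + s a) w) =
      ∑ p ∈ Finset.HasAntidiagonal.antidiagonal k, wordSum F p.1 fun u => wordSum F p.2 fun v =>
        shuffleSum M u v • (revProd l u * revProd s v) := by
  induction k generalizing M with
  | zero => simp
  | succ k ih =>
    -- `X` and `Y` collect the shuffles whose first letter comes from the l-word or the s-word. `Y'`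
    -- is `Y` with its second index shifted by one, and is 0 when the s-word is empty.
    let S (i j : ℕ) : A := wordSum F i fun u => wordSum F j fun v =>
        shuffleSum M u v • (revProd l u * revProd s v)
    let X (i j : ℕ) : A := ∑ a ∈ F, wordSum F i fun u => wordSum F j fun v =>
        shuffleSum (fun w => M (a :: w)) u v • (revProd l (a :: u) * revProd s v)
    let Y (i j : ℕ) : A := ∑ b ∈ F, wordSum F i fun u => wordSum F j fun v =>
        shuffleSum (fun w => M (b :: w)) u v • (revProd l u * revProd s (b :: v))
    let Y' (i j : ℕ) : A := match j with
      | 0 => 0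
      | j + 1 => Y i j
    have hS0 (j : ℕ) : S 0 (j + 1) = Y 0 j := by
      simp only [S, Y, wordSum_zero, wordSum_succ, shuffleSum_nil_left]
    have hS1 (i j : ℕ) : S (i + 1) j = X i j + Y' (i + 1) j := by
      cases j with
      | zero =>
        simp only [S, X, Y', wordSum_zero, wordSum_succ, shuffleSum_nil_right, add_zero]
      | succ j =>
        simp only [S, X, Y', Y]
        rw [wordSum_succ]
        simp only [wordSum_succ, shuffleSum_cons_cons, add_smul, Finset.sum_add_distrib,
          wordSum_add, sum_wordSum]
        congr 1
        exact wordSum_congr F fun _ _ => wordSum_congr F fun _ _ => Finset.sum_comm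
    have hL : (wordSum F (k + 1) fun w => M w • revProd (fun a => l a + s a) w) =
        ∑ p ∈ Finset.HasAntidiagonal.antidiagonal k, (X p.1 p.2 + Y p.1 p.2) := by
      rw [wordSum_succ]
      simp only [revProd_cons, ← smul_mul_assoc, ← wordSum_mul, ih, X, Y]
      simp only [← Finset.sum_add_distrib]
      rw [Finset.sum_comm]
      refine Finset.sum_congr rfl fun a _ => ?_
      rw [Finset.sum_mul]
      refine Finset.sum_congr rfl fun p _ => ?_
      rw [← wordSum_add, wordSum_mul]
      refine wordSum_congr F fun u _ => ?_
      rw [← wordSum_add, wordSum_mul]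
      refine wordSum_congr F fun v _ => ?_
      have hc := (commute_revProd (fun b => (hls a b).symm) v).eq
      simp only [mul_add, mul_assoc, hc]
    rw [hL, Finset.Nat.sum_antidiagonal_succ (f := fun p => S p.1 p.2)]
    have h1 := Finset.Nat.sum_antidiagonal_succ (n := k) (f := fun p => Y' p.1 p.2)
    have h2 := Finset.Nat.sum_antidiagonal_succ' (n := k) (f := fun p => Y' p.1 p.2)
    simp only [hS0, hS1, Finset.sum_add_distrib]
    rw [h2] at h1
    simp only [Y', zero_add] at h1
    rw [h1]
    abel

/-- Alternality kills every pair of subwords except those in which one is empty. -/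
theorem IsAlternal.wordSum_smul_revProd_add {M : List α → ℂ} (hM : IsAlternal M) {l s : α → A}
    (hls : ∀ a b, Commute (l a) (s b)) {k : ℕ} (hk : k ≠ 0) :
    (wordSum F k fun w => M w • revProd (fun a => l a + s a) w) =
      (wordSum F k fun w => M w • revProd l w) + wordSum F k fun w => M w • revProd s w := by
  obtain ⟨k, rfl⟩ := Nat.exists_eq_succ_of_ne_zero hk
  rw [_root_.wordSum_smul_revProd_add F hls]
  rw [← Finset.sum_subset (s₁ := {(k + 1, 0), (0, k + 1)})]
  · rw [Finset.sum_pair (by simp)]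
    simp
  · intro p hp
    rw [Finset.mem_insert, Finset.mem_singleton] at hp
    rcases hp with rfl | rfl <;> simp
  · rintro ⟨i, j⟩ hp hne
    rw [Finset.HasAntidiagonal.mem_antidiagonal] at hp
    simp only [Finset.mem_insert, Finset.mem_singleton, Prod.mk.injEq, not_or] at hne
    refine wordSum_eq_zero F fun u hu => wordSum_eq_zero F fun v hv => ?_
    rw [hM u v, zero_smul]
    · rintro rfl
      simp only [List.length_nil] at hu
      simp only at hp
      omega
    · rintro rfl
      simp only [List.length_nil] at hv
      simp only at hp
      omega

/-- The iterated commutator with the letters of a word. -/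
def iterBracket (f : α → A) (w : List α) (y : A) : A :=
  w.foldl (fun y b => f b * y - y * f b) y

theorem iterBracket_smul (f : α → A) (w : List α) (c : ℂ) (y : A) :
    iterBracket f w (c • y) = c • iterBracket f w y := by
  induction w generalizing y with
  | nil => rfl
  | cons b w ih =>
    simp only [iterBracket, List.foldl_cons] at ih ⊢
    rw [← ih, smul_sub, mul_smul_comm, smul_mul_assoc]

/-- The iterated commutator of the letters of a word, read from right to left. -/
def wordBracket (f : α → A) : List α → A
  | [] => 0
  | a :: w => iterBracket f w (f a)

/-- The Dynkin–Specht–Wever identity. -/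
theorem IsAlternal.wordSum_smul_wordBracket {M : List α → ℂ} (hM : IsAlternal M) (f : α → A)
    {k : ℕ} (hk : k ≠ 0) :
    (wordSum F k fun w => M w • wordBracket f w) =
      (k : ℂ) • wordSum F k fun w => M w • revProd f w := by
  -- A pair (x, y) stands for x + yδ with δ² = 0; l is left multiplication by (1 + δ) f a and s is
  -- minus right multiplication by f a. Applied to 1, the sum l + s first gives δ f a and then
  -- iterated commutators. Words in l alone have δ-part |w| times the product, which supplies the
  -- factor k; words in s alone have none.
  let l (a : α) : Module.End ℂ (A × A) :=
    ((LinearMap.mulLeft ℂ (f a)).comp (LinearMap.fst ℂ A A)).prod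
      ((LinearMap.mulLeft ℂ (f a)).comp (LinearMap.fst ℂ A A + LinearMap.snd ℂ A A))
  let s (a : α) : Module.End ℂ (A × A) :=
    ((-LinearMap.mulRight ℂ (f a)).comp (LinearMap.fst ℂ A A)).prod
      ((-LinearMap.mulRight ℂ (f a)).comp (LinearMap.snd ℂ A A))
  have hl (a : α) (z : A × A) : l a z = (f a * z.1, f a * (z.1 + z.2)) := rfl
  have hs (a : α) (z : A × A) : s a z = (-(z.1 * f a), -(z.2 * f a)) := rfl
  have hls (a b : α) : Commute (l a) (s b) := by
    refine LinearMap.ext fun z => ?_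
    simp only [Module.End.mul_apply, hl, hs, Prod.mk.injEq]
    constructor <;> noncomm_ring
  have hL (w : List α) (x y : A) : revProd l w (x, y) =
      (revProd f w * x, revProd f w * y + (w.length : ℂ) • (revProd f w * x)) := by
    induction w generalizing x y with
    | nil => simp
    | cons a w ih =>
      rw [revProd_cons, Module.End.mul_apply, hl, ih, revProd_cons]
      simp only [Prod.mk.injEq, mul_assoc, List.length_cons, Nat.cast_add, Nat.cast_one, add_smul,
        one_smul, mul_add, true_and]
      abel
  have hR (w : List α) (x : A) : (revProd s w (x, 0)).2 = 0 := by
    induction w generalizing x with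
    | nil => simp
    | cons a w ih =>
      rw [revProd_cons, Module.End.mul_apply, hs]
      simp only [zero_mul, neg_zero]
      exact ih _
  have hB' (w : List α) (y : A) :
      revProd (fun a => l a + s a) w (0, y) = (0, iterBracket f w y) := by
    induction w generalizing y with
    | nil => simp [iterBracket]
    | cons a w ih =>
      rw [revProd_cons, Module.End.mul_apply, LinearMap.add_apply, hl, hs]
      simp only [mul_zero, zero_mul, neg_zero, zero_add, Prod.mk_add_mk, ← sub_eq_add_neg, ih]
      rfl
  have hB (w : List α) : (revProd (fun a => l a + s a) w (1, 0)).2 = wordBracket f w := by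
    cases w with
    | nil => simp [wordBracket]
    | cons a w =>
      rw [revProd_cons, Module.End.mul_apply, LinearMap.add_apply, hl, hs]
      simp only [mul_one, one_mul, zero_mul, neg_zero, add_zero, Prod.mk_add_mk, add_neg_cancel,
        hB', wordBracket]
  have key := congrArg (fun T : Module.End ℂ (A × A) => (T (1, 0)).2)
    (hM.wordSum_smul_revProd_add F hls hk)
  let ev : Module.End ℂ (A × A) →ₗ[ℂ] A :=
    (LinearMap.snd ℂ A A).comp (LinearMap.applyₗ ((1, 0) : A × A))
  change ev _ = ev (_ + _) at key
  have hev (T : Module.End ℂ (A × A)) : ev T = (T (1, 0)).2 := rfl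
  simp only [map_add, map_wordSum, map_smul] at key
  simp only [hev, hB, hL, hR, smul_zero, mul_one, mul_zero, zero_add] at key
  rw [key, smul_wordSum, wordSum_eq_zero F (g := fun _ => (0 : A)) fun _ _ => rfl, add_zero]
  refine wordSum_congr F fun w hw => ?_
  rw [hw, smul_comm]

theorem nestedBracket_append_singleton (hbar : ℝ) (l : List A) (x : A) :
    nestedBracket hbar (l ++ [x]) = l.foldr (quantumBracket hbar) x := by
  induction l with
  | nil => rfl
  | cons a l ih =>
    rw [List.foldr_cons, ← ih]
    cases l <;> rfl

/-- A word of k letters carries k factors 1/(iħ) but only k - 1 brackets, hence the compensating iħ.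
-/
theorem nestedBracket_reverse {hbar : ℝ} (hh : Complex.I * (hbar : ℂ) ≠ 0) (v : α → A)
    {w : List α} :
    nestedBracket hbar (w.reverse.map v) =
      (Complex.I * (hbar : ℂ)) • wordBracket (fun a => (Complex.I * (hbar : ℂ))⁻¹ • v a) w := by
  cases w with
  | nil => simp [nestedBracket, wordBracket]
  | cons a w =>
    rw [List.reverse_cons, List.map_append, List.map_singleton, nestedBracket_append_singleton,
      List.foldr_map, List.foldr_reverse, wordBracket, ← iterBracket_smul, smul_inv_smul₀ hh,
      iterBracket]
    congr 1
    funext y b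
    rw [quantumBracket, smul_sub, smul_mul_assoc, mul_smul_comm]

end Dynkin

/-! ### Exponentials of formal series with operator coefficients -/

section FormalExp

variable {A : Type*} [Ring A]

theorem coeff_pow_mul_eq_zero {Y : PowerSeries A} (hY : PowerSeries.coeff 0 Y = 0)
    (Z : PowerSeries A) {n j : ℕ} (h : n < j) : PowerSeries.coeff n (Y ^ j * Z) = 0 := by
  induction j generalizing n Z with
  | zero => omega
  | succ j ih =>
    rw [pow_succ', mul_assoc, PowerSeries.coeff_mul]
    refine Finset.sum_eq_zero fun p hp => ?_
    have hp := Finset.HasAntidiagonal.mem_antidiagonal.1 hp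
    rcases Nat.eq_zero_or_pos p.1 with h0 | h0
    · rw [h0, hY, zero_mul]
    · rw [ih Z (by omega), mul_zero]

theorem coeff_pow_eq_zero {Y : PowerSeries A} (hY : PowerSeries.coeff 0 Y = 0) {n j : ℕ}
    (h : n < j) : PowerSeries.coeff n (Y ^ j) = 0 := by
  simpa using coeff_pow_mul_eq_zero hY 1 h

theorem coeff_pow_congr {Y Y' : PowerSeries A} {n : ℕ}
    (h : ∀ i < n, PowerSeries.coeff i Y = PowerSeries.coeff i Y') (j : ℕ) {i : ℕ} (hi : i < n) :
    PowerSeries.coeff i (Y ^ j) = PowerSeries.coeff i (Y' ^ j) := by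
  induction j generalizing i with
  | zero => rfl
  | succ j ih =>
    rw [pow_succ, pow_succ, PowerSeries.coeff_mul, PowerSeries.coeff_mul]
    refine Finset.sum_congr rfl fun p hp => ?_
    have hp := Finset.HasAntidiagonal.mem_antidiagonal.1 hp
    rw [ih (by omega), h _ (by omega)]

/-- In a product of at least two factors, an order-n coefficient of one factor meets only constant
terms of the others, which vanish. -/
theorem coeff_pow_congr_of_two_le {Y Y' : PowerSeries A} (hY : PowerSeries.coeff 0 Y = 0)
    (hY' : PowerSeries.coeff 0 Y' = 0) {n : ℕ}
    (h : ∀ i < n, PowerSeries.coeff i Y = PowerSeries.coeff i Y') {j : ℕ} (hj : 2 ≤ j) :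
    PowerSeries.coeff n (Y ^ j) = PowerSeries.coeff n (Y' ^ j) := by
  obtain ⟨j, rfl⟩ := Nat.exists_eq_add_of_le' (show 1 ≤ j by omega)
  rw [pow_succ, pow_succ, PowerSeries.coeff_mul, PowerSeries.coeff_mul]
  refine Finset.sum_congr rfl fun p hp => ?_
  have hp := Finset.HasAntidiagonal.mem_antidiagonal.1 hp
  rcases Nat.eq_zero_or_pos p.1 with h1 | h1
  · rw [h1, coeff_pow_eq_zero hY (by omega), coeff_pow_eq_zero hY' (by omega), zero_mul, zero_mul]
  · rcases Nat.eq_zero_or_pos p.2 with h2 | h2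
    · rw [h2, hY, hY', mul_zero, mul_zero]
    · rw [coeff_pow_congr h j (by omega), h _ (by omega)]

variable [Algebra ℂ A]

theorem coeff_formalExp (Y : PowerSeries A) (n : ℕ) :
    PowerSeries.coeff n (formalExp Y) =
      ∑ j ∈ Finset.range (n + 1), ((j.factorial : ℂ)⁻¹) • PowerSeries.coeff n (Y ^ j) :=
  PowerSeries.coeff_mk _ _

theorem coeff_zero_formalExp (Y : PowerSeries A) : PowerSeries.coeff 0 (formalExp Y) = 1 := by
  simp [coeff_formalExp]

theorem coeff_formalExp_congr {Y Y' : PowerSeries A} {n : ℕ}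
    (h : ∀ i < n, PowerSeries.coeff i Y = PowerSeries.coeff i Y') {i : ℕ} (hi : i < n) :
    PowerSeries.coeff i (formalExp Y) = PowerSeries.coeff i (formalExp Y') := by
  rw [coeff_formalExp, coeff_formalExp]
  refine Finset.sum_congr rfl fun j _ => ?_
  rw [coeff_pow_congr h j hi]

/-- The dependence of a coefficient of the exponential on the coefficient of the same order. -/
theorem coeff_formalExp_sub {Y Y' : PowerSeries A} (hY : PowerSeries.coeff 0 Y = 0)
    (hY' : PowerSeries.coeff 0 Y' = 0) {n : ℕ} (hn : n ≠ 0)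
    (h : ∀ i < n, PowerSeries.coeff i Y = PowerSeries.coeff i Y') :
    PowerSeries.coeff n (formalExp Y) - PowerSeries.coeff n (formalExp Y') =
      PowerSeries.coeff n Y - PowerSeries.coeff n Y' := by
  rw [coeff_formalExp, coeff_formalExp, ← Finset.sum_sub_distrib,
    Finset.sum_eq_single_of_mem 1 (by simp; omega)]
  · simp
  · intro j _ hj
    rcases Nat.eq_zero_or_pos j with rfl | h0
    · simp
    · rw [coeff_pow_congr_of_two_le hY hY' h (by omega), sub_self]

/-- Reduces exponentials over a noncommutative ring to polynomials in the single element `Y`, so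
that identities can be imported from ℂ[[X]]. -/
theorem coeff_formalExp_eq_coeff_aeval {Y : PowerSeries A} (hY : PowerSeries.coeff 0 Y = 0)
    {n m : ℕ} (h : n ≤ m) :
    PowerSeries.coeff n (formalExp Y) =
      PowerSeries.coeff n (Polynomial.aeval Y (PowerSeries.trunc (m + 1) (PowerSeries.exp ℂ))) := by
  rw [coeff_formalExp, Polynomial.aeval_eq_sum_range' (PowerSeries.natDegree_trunc_lt _ m),
    map_sum]
  refine Finset.sum_subset_zero_on_sdiff (Finset.range_mono (by omega)) ?_ ?_
  · intro j hj
    simp only [Finset.mem_sdiff, Finset.mem_range] at hj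
    rw [PowerSeries.coeff_smul, coeff_pow_eq_zero hY (by omega), smul_zero]
  · intro j hj
    have hj' := Finset.mem_range.1 hj
    rw [PowerSeries.coeff_smul, PowerSeries.coeff_trunc, if_pos (by omega), PowerSeries.coeff_exp]
    simp

theorem formalExp_mul_formalExp_neg {Y : PowerSeries A} (hY : PowerSeries.coeff 0 Y = 0) :
    formalExp Y * formalExp (-Y) = 1 := by
  ext n
  have hY' : PowerSeries.coeff 0 (-Y) = 0 := by rw [map_neg, hY, neg_zero]
  set e : Polynomial ℂ := PowerSeries.trunc (n + 1) (PowerSeries.exp ℂ)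
  have h1 : PowerSeries.coeff n (formalExp Y * formalExp (-Y)) =
      PowerSeries.coeff n (Polynomial.aeval Y (e * e.comp (-Polynomial.X))) := by
    rw [map_mul (Polynomial.aeval Y), Polynomial.aeval_comp, map_neg (Polynomial.aeval (R := ℂ) Y),
      Polynomial.aeval_X, PowerSeries.coeff_mul, PowerSeries.coeff_mul]
    refine Finset.sum_congr rfl fun p hp => ?_
    have hp := Finset.HasAntidiagonal.mem_antidiagonal.1 hp
    rw [coeff_formalExp_eq_coeff_aeval hY (show p.1 ≤ n by omega),
      coeff_formalExp_eq_coeff_aeval hY' (show p.2 ≤ n by omega)]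
  -- This is e^X e^(-X) = 1 modulo X^(n+1); after substitution, multiples of Y^(n+1) do not reach
  -- degree n.
  have h2 : Polynomial.X ^ (n + 1) ∣ e * e.comp (-Polynomial.X) - 1 := by
    rw [Polynomial.X_pow_dvd_iff]
    intro i hi
    have h3 := congrArg (PowerSeries.coeff i) (PowerSeries.exp_mul_exp_neg_eq_one (A := ℂ))
    rw [PowerSeries.coeff_mul] at h3
    rw [Polynomial.coeff_sub, Polynomial.coeff_mul, sub_eq_zero]
    have h4 : (1 : Polynomial ℂ).coeff i = PowerSeries.coeff i (1 : PowerSeries ℂ) := by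
      rw [Polynomial.coeff_one, PowerSeries.coeff_one]
    rw [h4, ← h3]
    refine Finset.sum_congr rfl fun p hp => ?_
    have hp := Finset.HasAntidiagonal.mem_antidiagonal.1 hp
    rw [← neg_one_mul (Polynomial.X : Polynomial ℂ), ← Polynomial.C_1, ← Polynomial.C_neg,
      Polynomial.comp_C_mul_X_coeff, PowerSeries.coeff_trunc, PowerSeries.coeff_trunc,
      if_pos (by omega), if_pos (by omega), PowerSeries.evalNegHom, PowerSeries.coeff_rescale,
      mul_comm ((-1 : ℂ) ^ p.2)]
  obtain ⟨q, hq⟩ := h2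
  rw [h1, sub_eq_iff_eq_add.1 hq, map_add, map_mul, map_pow, Polynomial.aeval_X, map_one, map_add,
    coeff_pow_mul_eq_zero hY _ (Nat.lt_succ_self n), zero_add]

end FormalExp

/-! ### Formal adjoints -/

section Adjoint

variable {E : Type*} [NormedAddCommGroup E] [InnerProductSpace ℂ E]

/-- The coefficients of `Q` are formal adjoints of the coefficients of `P`. -/
def IsFormalAdjoint (P Q : PowerSeries (Module.End ℂ E)) : Prop :=
  ∀ k x y, inner ℂ ((PowerSeries.coeff k P : Module.End ℂ E) x) y =
    inner ℂ x ((PowerSeries.coeff k Q : Module.End ℂ E) y)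

namespace IsFormalAdjoint

variable {P Q P' Q' : PowerSeries (Module.End ℂ E)}

theorem one : IsFormalAdjoint (1 : PowerSeries (Module.End ℂ E)) 1 := by
  intro k x y
  rw [PowerSeries.coeff_one]
  split_ifs <;> simp

theorem smul (h : IsFormalAdjoint P Q) (c : ℂ) :
    IsFormalAdjoint (c • P) ((starRingEnd ℂ) c • Q) := by
  intro k x y
  simp only [PowerSeries.coeff_smul, LinearMap.smul_apply]
  rw [inner_smul_left, inner_smul_right, h]

theorem mul (h : IsFormalAdjoint P Q) (h' : IsFormalAdjoint P' Q') :
    IsFormalAdjoint (P * P') (Q' * Q) := by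
  intro k x y
  rw [PowerSeries.coeff_mul, PowerSeries.coeff_mul, ← Finset.Nat.sum_antidiagonal_swap]
  simp only [LinearMap.sum_apply, sum_inner, inner_sum, Module.End.mul_apply]
  refine Finset.sum_congr rfl fun p _ => ?_
  rw [h, h']
  rfl

theorem pow (h : IsFormalAdjoint P Q) (n : ℕ) : IsFormalAdjoint (P ^ n) (Q ^ n) := by
  induction n with
  | zero => exact one
  | succ n ih =>
    rw [pow_succ, pow_succ']
    exact ih.mul h

theorem formalExp (h : IsFormalAdjoint P Q) : IsFormalAdjoint (formalExp P) (formalExp Q) := by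
  intro k x y
  simp only [coeff_formalExp, LinearMap.sum_apply, sum_inner, inner_sum, LinearMap.smul_apply]
  refine Finset.sum_congr rfl fun j _ => ?_
  rw [inner_smul_left, inner_smul_right, h.pow j]
  simp

end IsFormalAdjoint

end Adjoint

namespace SimpleHamiltonian

variable {H : Type*} [NormedAddCommGroup H] [InnerProductSpace ℂ H] [CompleteSpace H] {J : Set ℕ}
  (S : SimpleHamiltonian H J)

/-! ### Matrix entries of operators on the span of the eigenvectors -/

/-- The matrix entries of an operator in the basis of eigenvectors. -/
def entry (k l : J) : Module.End ℂ S.core →ₗ[ℂ] ℂ :=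
  (S.coreBasis.coord k).comp (LinearMap.applyₗ (S.coreBasis l))

theorem entry_apply (k l : J) (T : Module.End ℂ S.core) :
    S.entry k l T = S.coreBasis.repr (T (S.coreBasis l)) k := rfl

variable {S} in
theorem ext_entry {T T' : Module.End ℂ S.core} (h : ∀ k l, S.entry k l T = S.entry k l T') :
    T = T' :=
  S.coreBasis.ext fun l => S.coreBasis.repr.injective (Finsupp.ext fun k => h k l)

theorem coreOp_coreBasis (l : J) : S.coreOp (S.coreBasis l) = (S.E l : ℂ) • S.coreBasis l := by
  obtain ⟨h, hl⟩ := S.eigen l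
  apply Subtype.ext
  rw [Submodule.coe_smul, S.coe_coreBasis, ← hl]
  change S.op ⟨(S.coreBasis l : H), _⟩ = _
  congr 1
  exact Subtype.ext (S.coe_coreBasis l)

theorem repr_coreOp (x : S.core) (k : J) :
    S.coreBasis.repr (S.coreOp x) k = S.E k * S.coreBasis.repr x k := by
  suffices h : (S.coreBasis.coord k).comp S.coreOp = (S.E k : ℂ) • S.coreBasis.coord k from
    LinearMap.congr_fun h x
  refine S.coreBasis.ext fun l => ?_
  rw [LinearMap.comp_apply, coreOp_coreBasis, map_smul, LinearMap.smul_apply,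
    Module.Basis.coord_apply, Module.Basis.repr_self, smul_eq_mul, smul_eq_mul,
    Finsupp.single_apply]
  split_ifs with h
  · rw [h]
  · rw [mul_zero, mul_zero]

theorem entry_coreOp_mul (k l : J) (T : Module.End ℂ S.core) :
    S.entry k l (S.coreOp * T) = S.E k * S.entry k l T := by
  rw [entry_apply, Module.End.mul_apply, repr_coreOp, entry_apply]

theorem entry_mul_coreOp (k l : J) (T : Module.End ℂ S.core) :
    S.entry k l (T * S.coreOp) = S.E l * S.entry k l T := by
  rw [entry_apply, Module.End.mul_apply, coreOp_coreBasis, map_smul, map_smul, Finsupp.smul_apply,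
    entry_apply, smul_eq_mul]

variable {S} in
theorem sub_ne_zero_of_ne {k l : J} (h : k ≠ l) : (S.E k : ℂ) - S.E l ≠ 0 := by
  rw [sub_ne_zero]
  exact fun h' => h (S.simple (by exact_mod_cast h'))

variable {S} in
-- The entries of [H₀, T] are (E_k - E_l) T_kl, with nonzero factors off the diagonal.
theorem commute_coreOp_iff {T : Module.End ℂ S.core} :
    Commute S.coreOp T ↔ ∀ k l, k ≠ l → S.entry k l T = 0 := by
  constructor
  · intro h k l hkl
    have h1 := congrArg (S.entry k l) h.eq
    rw [entry_coreOp_mul, entry_mul_coreOp, ← sub_eq_zero, ← sub_mul] at h1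
    exact (mul_eq_zero.1 h1).resolve_left (sub_ne_zero_of_ne hkl)
  · intro h
    refine ext_entry fun k l => ?_
    rw [entry_coreOp_mul, entry_mul_coreOp]
    rcases eq_or_ne k l with rfl | hkl
    · rfl
    · rw [h k l hkl, mul_zero, mul_zero]

variable {S} in
theorem commute_of_commute_bracket {T : Module.End ℂ S.core}
    (h : Commute S.coreOp (S.coreOp * T - T * S.coreOp)) : Commute S.coreOp T := by
  rw [commute_coreOp_iff] at h ⊢
  intro k l hkl
  have h1 := h k l hkl
  rw [map_sub, entry_coreOp_mul, entry_mul_coreOp, ← sub_mul] at h1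
  exact (mul_eq_zero.1 h1).resolve_left (sub_ne_zero_of_ne hkl)

variable {S} in
theorem apply_coreBasis_of_commute {T : Module.End ℂ S.core} (h : Commute S.coreOp T) (l : J) :
    T (S.coreBasis l) = S.entry l l T • S.coreBasis l := by
  refine S.coreBasis.repr.injective (Finsupp.ext fun k => ?_)
  rw [map_smul, Finsupp.smul_apply, Module.Basis.repr_self, Finsupp.single_apply]
  split_ifs with hkl
  · rw [hkl, smul_eq_mul, mul_one, entry_apply]
  · rw [smul_zero]
    exact commute_coreOp_iff.1 h k l (Ne.symm hkl)

variable {S} in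
/-- Since the eigenvalues are simple, the commutant of `H₀` is commutative. -/
theorem commute_of_commute_coreOp {T T' : Module.End ℂ S.core} (h : Commute S.coreOp T)
    (h' : Commute S.coreOp T') : Commute T T' := by
  refine S.coreBasis.ext fun l => ?_
  rw [Module.End.mul_apply, Module.End.mul_apply, apply_coreBasis_of_commute h',
    apply_coreBasis_of_commute h, map_smul, map_smul, apply_coreBasis_of_commute h,
    apply_coreBasis_of_commute h', smul_comm]

/-! ### Uniqueness of the normal form -/

variable {S} in
/-- Two normal forms which are formally conjugate, by a series with leading term `1`, are equal. -/
theorem normalForm_unique {X N N' : PowerSeries (Module.End ℂ S.core)}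
    (hX : PowerSeries.coeff 0 X = 1) (hN0 : PowerSeries.coeff 0 N = 0)
    (hN0' : PowerSeries.coeff 0 N' = 0) (hN : ∀ k, Commute S.coreOp (PowerSeries.coeff k N))
    (hN' : ∀ k, Commute S.coreOp (PowerSeries.coeff k N'))
    (h : X * (PowerSeries.C S.coreOp + N) = (PowerSeries.C S.coreOp + N') * X) : N = N' := by
  have hcX : ∀ n, Commute S.coreOp (PowerSeries.coeff n X) := by
    intro n
    induction n using Nat.strong_induction_on with
    | _ n ih =>
      refine commute_of_commute_bracket ?_
      have h1 := congrArg (PowerSeries.coeff n) h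
      rw [mul_add, add_mul, map_add, map_add, PowerSeries.coeff_mul_C, PowerSeries.coeff_C_mul,
        add_comm] at h1
      -- The bracket [H₀, X_n] is a combination of terms X_i N_j and N'_j X_i. Those with j = 0
      -- vanish and the others have i < n, so all of it commutes with H₀ by induction.
      rw [sub_eq_sub_iff_add_eq_add.2 h1.symm, PowerSeries.coeff_mul, PowerSeries.coeff_mul]
      refine .sub_right (.sum_right _ _ _ fun p hp => ?_) (.sum_right _ _ _ fun p hp => ?_)
      all_goals have hp := Finset.HasAntidiagonal.mem_antidiagonal.1 hp
      · rcases Nat.eq_zero_or_pos p.2 with h0 | h0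
        · rw [h0, hN0, mul_zero]
          exact Commute.zero_right _
        · exact (ih p.1 (by omega)).mul_right (hN _)
      · rcases Nat.eq_zero_or_pos p.1 with h0 | h0
        · rw [h0, hN0', zero_mul]
          exact Commute.zero_right _
        · exact (hN' _).mul_right (ih p.2 (by omega))
  -- Now X commutes with H₀, and also with N' because the commutant is commutative. The leading
  -- coefficient 1 then allows X to be cancelled.
  have hXN : X * (N - N') = 0 := by
    have h1 : PowerSeries.C S.coreOp * X = X * PowerSeries.C S.coreOp := by
      ext1 n
      rw [PowerSeries.coeff_mul_C, PowerSeries.coeff_C_mul, (hcX n).eq]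
    have h2 : N' * X = X * N' := by
      ext1 n
      rw [PowerSeries.coeff_mul, PowerSeries.coeff_mul, ← Finset.Nat.sum_antidiagonal_swap]
      exact Finset.sum_congr rfl fun p _ => commute_of_commute_coreOp (hN' _) (hcX _)
    rw [mul_add, add_mul, h1, h2] at h
    rw [mul_sub, sub_eq_zero]
    exact add_left_cancel h
  rw [← sub_eq_zero]
  ext1 n
  rw [map_zero]
  induction n using Nat.strong_induction_on with
  | _ n ih =>
    have h1 := congrArg (PowerSeries.coeff n) hXN
    rw [PowerSeries.coeff_mul, Finset.sum_eq_single_of_mem (0, n) (by simp), hX, one_mul,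
      map_zero] at h1
    · exact h1
    · intro p hp hne
      have hp := Finset.HasAntidiagonal.mem_antidiagonal.1 hp
      have h0 : p.1 ≠ 0 := fun h0 => hne (Prod.ext h0 (by simp only; omega))
      rw [ih p.2 (by omega), mul_zero]

/-! ### Components of the perturbation -/

section Components

variable {S} {hbar : ℝ} {V : H →L[ℂ] H}

theorem entry_component (hh : 0 < hbar) (V : H →L[ℂ] H) (z : ℂ) (k l : J) :
    S.entry k l (S.component hbar V z) =
      if (S.E k : ℂ) - S.E l = Complex.I * hbar * z then inner ℂ (S.e k) (V (S.e l)) else 0 := by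
  have h0 : Complex.I * (hbar : ℂ) ≠ 0 :=
    mul_ne_zero Complex.I_ne_zero (by exact_mod_cast hh.ne')
  rw [entry_apply]
  by_cases h : ∃ m : J, (S.E m : ℂ) - S.E l = Complex.I * hbar * z
  · obtain ⟨m, hm⟩ := h
    have hz : z = ((S.E m : ℂ) - S.E l) / (Complex.I * hbar) := by
      rw [hm, mul_div_cancel_left₀ _ h0]
    rw [← hm]
    rw [hz, S.component_coreBasis hh, map_smul, Finsupp.smul_apply, Module.Basis.repr_self,
      Finsupp.single_apply]
    by_cases hkm : m = k
    · subst hkm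
      simp
    · rw [if_neg hkm, if_neg, smul_zero]
      intro h'
      exact hkm (S.simple (by exact_mod_cast (sub_left_injective h').symm))
  · push Not at h
    rw [component, Module.Basis.constr_basis, if_neg (h k), finsum_eq_zero_of_forall_eq_zero]
    · simp
    · intro m
      simp only [h m, finsum_false]

theorem coreOp_bracket_component (hh : 0 < hbar) (V : H →L[ℂ] H) (z : ℂ) :
    S.coreOp * S.component hbar V z - S.component hbar V z * S.coreOp =
      (Complex.I * hbar * z) • S.component hbar V z := by
  refine ext_entry fun k l => ?_
  rw [map_sub, entry_coreOp_mul, entry_mul_coreOp, map_smul, entry_component hh, smul_eq_mul,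
    ← sub_mul]
  split_ifs with h
  · rw [h]
  · rw [mul_zero, mul_zero]

theorem repr_eq_inner (x : S.core) (k : J) :
    S.coreBasis.repr x k = inner ℂ (S.e k) (x : H) := by
  suffices h : S.coreBasis.coord k =
      (innerₛₗ ℂ (S.e k)).comp S.core.subtype from LinearMap.congr_fun h x
  refine S.coreBasis.ext fun l => ?_
  rw [Module.Basis.coord_apply, Module.Basis.repr_self, LinearMap.comp_apply,
    Submodule.subtype_apply, S.coe_coreBasis, innerₛₗ_apply_apply, Finsupp.single_apply,
    orthonormal_iff_ite.1 S.e.orthonormal]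
  simp only [eq_comm]

theorem coe_corePerturbation (hh : 0 < hbar) (hV : S.FiniteBand hbar V) (x : S.core) :
    (S.corePerturbation hh hV x : H) = V x := rfl

theorem entry_corePerturbation (hh : 0 < hbar) (hV : S.FiniteBand hbar V) (k l : J) :
    S.entry k l (S.corePerturbation hh hV) = inner ℂ (S.e k) (V (S.e l)) := by
  rw [entry_apply, repr_eq_inner, coe_corePerturbation, S.coe_coreBasis]

/-- The finite set of frequencies of a finite-band perturbation. -/
def band (hV : S.FiniteBand hbar V) : Finset (S.frequencies hbar) := Set.Finite.toFinset hV

theorem mem_band {hV : S.FiniteBand hbar V} {z : S.frequencies hbar} :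
    z ∈ band hV ↔ S.component hbar V z ≠ 0 :=
  Set.Finite.mem_toFinset (s := {z : S.frequencies hbar | S.component hbar V z ≠ 0}) hV

/-- Each matrix entry belongs to exactly one frequency, and it is zero if that frequency lies
outside the band. -/
theorem corePerturbation_eq_sum (hh : 0 < hbar) (hV : S.FiniteBand hbar V) :
    S.corePerturbation hh hV = ∑ z ∈ band hV, S.component hbar V z := by
  have h0 : Complex.I * (hbar : ℂ) ≠ 0 :=
    mul_ne_zero Complex.I_ne_zero (by exact_mod_cast hh.ne')
  refine ext_entry fun k l => ?_
  let z₀ : S.frequencies hbar := ⟨((S.E k : ℂ) - S.E l) / (Complex.I * hbar), k, l, rfl⟩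
  have hz₀ : (S.E k : ℂ) - S.E l = Complex.I * hbar * z₀ := (mul_div_cancel₀ _ h0).symm
  rw [entry_corePerturbation, map_sum, Finset.sum_eq_single z₀]
  · rw [entry_component hh, if_pos hz₀]
  · intro z _ hz
    rw [entry_component hh, if_neg]
    rw [hz₀]
    exact fun h => hz (Subtype.ext (mul_left_cancel₀ h0 h).symm)
  · intro h
    have h1 : S.component hbar V z₀ = 0 := by
      by_contra h1
      exact h (mem_band.2 h1)
    rw [h1, map_zero]

end Components

/-! ### Existence of a symmetric normalizing generator -/

section Existence

variable {S}

theorem isSymmetric_iff_entry {T : Module.End ℂ S.core} :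
    T.IsSymmetric ↔ ∀ k l, (starRingEnd ℂ) (S.entry k l T) = S.entry l k T := by
  have hin (x : S.core) (k : J) : inner ℂ (S.coreBasis k) x = S.coreBasis.repr x k := by
    rw [repr_eq_inner, Submodule.coe_inner, S.coe_coreBasis]
  constructor
  · intro h k l
    rw [entry_apply, entry_apply, ← hin, ← hin, inner_conj_symm]
    exact h _ _
  · intro h x y
    have h1 : (innerₛₗ ℂ (E := S.core)).comp T = (innerₛₗ ℂ (E := S.core)).compl₂ T := by
      refine LinearMap.ext_basis S.coreBasis S.coreBasis fun k l => ?_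
      rw [LinearMap.comp_apply, LinearMap.compl₂_apply, innerₛₗ_apply_apply, innerₛₗ_apply_apply,
        ← inner_conj_symm, hin, hin]
      exact h l k
    exact LinearMap.congr_fun₂ h1 x y

theorem isSymmetric_coreOp : S.coreOp.IsSymmetric := by
  rw [isSymmetric_iff_entry]
  intro k l
  rw [entry_apply, entry_apply, repr_coreOp, repr_coreOp, Module.Basis.repr_self,
    Module.Basis.repr_self, Finsupp.single_apply, Finsupp.single_apply]
  rcases eq_or_ne k l with rfl | h
  · simp
  · simp [h, h.symm]

theorem isSymmetric_corePerturbation {hbar : ℝ} (hh : 0 < hbar) {V : H →L[ℂ] H}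
    (hsa : IsSelfAdjoint V) (hV : S.FiniteBand hbar V) :
    (S.corePerturbation hh hV).IsSymmetric := fun x y => by
  rw [Submodule.coe_inner, Submodule.coe_inner, coe_corePerturbation, coe_corePerturbation]
  exact hsa.isSymmetric _ _

/-- The solution `w`, without diagonal entries, of the homological equation: the off-diagonal
entries of `(1/iħ)[w, H₀] + R` vanish. -/
def homologicalSolution (hbar : ℝ) (R : Module.End ℂ S.core) : Module.End ℂ S.core :=
  S.coreBasis.constr ℂ fun l => S.coreBasis.repr.symm
    (Finsupp.onFinset (S.coreBasis.repr (R (S.coreBasis l))).support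
      -- For k = l the denominator is 0, and division by zero gives the diagonal entry the value 0.
      -- Columns stay finitely supported because those of `R` are.
      (fun k => Complex.I * hbar * S.entry k l R / (S.E k - S.E l))
      fun k hk => by
        rw [Finsupp.mem_support_iff]
        intro h
        rw [entry_apply, h, mul_zero, zero_div] at hk
        exact hk rfl)

theorem entry_homologicalSolution (hbar : ℝ) (R : Module.End ℂ S.core) (k l : J) :
    S.entry k l (homologicalSolution hbar R) =
      Complex.I * hbar * S.entry k l R / (S.E k - S.E l) := by
  rw [entry_apply, homologicalSolution, Module.Basis.constr_basis, LinearEquiv.apply_symm_apply,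
    Finsupp.onFinset_apply]

theorem isSymmetric_homologicalSolution (hbar : ℝ) {R : Module.End ℂ S.core}
    (hR : R.IsSymmetric) : (homologicalSolution hbar R).IsSymmetric := by
  rw [isSymmetric_iff_entry] at hR ⊢
  intro k l
  rw [entry_homologicalSolution, entry_homologicalSolution, map_div₀, map_mul, map_mul, hR,
    map_sub, Complex.conj_I, Complex.conj_ofReal, Complex.conj_ofReal, Complex.conj_ofReal,
    neg_mul, neg_mul, neg_div, ← div_neg, neg_sub]

theorem commute_homologicalSolution {hbar : ℝ} (hh : 0 < hbar) (R : Module.End ℂ S.core) :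
    Commute S.coreOp (R + (Complex.I * (hbar : ℂ))⁻¹ •
      (homologicalSolution hbar R * S.coreOp - S.coreOp * homologicalSolution hbar R)) := by
  have h0 : Complex.I * (hbar : ℂ) ≠ 0 :=
    mul_ne_zero Complex.I_ne_zero (by exact_mod_cast hh.ne')
  rw [commute_coreOp_iff]
  intro k l hkl
  have h1 := sub_ne_zero_of_ne (S := S) hkl
  rw [map_add, map_smul, map_sub, entry_coreOp_mul, entry_mul_coreOp, entry_homologicalSolution,
    smul_eq_mul, ← sub_mul, ← neg_sub (S.E k : ℂ), neg_mul, mul_div_cancel₀ _ h1, mul_neg,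
    inv_mul_cancel_left₀ h0, add_neg_cancel]

variable {hbar : ℝ} (hh : 0 < hbar) {V : H →L[ℂ] H} (hV : S.FiniteBand hbar V)

/-- The conjugate `e^{W/iħ} (H₀ + μ V) e^{-W/iħ}`. -/
def conjugate (W : PowerSeries (Module.End ℂ S.core)) : PowerSeries (Module.End ℂ S.core) :=
  formalExp ((Complex.I * (hbar : ℂ))⁻¹ • W) *
    (PowerSeries.C S.coreOp + PowerSeries.X * PowerSeries.C (S.corePerturbation hh hV)) *
    formalExp (-((Complex.I * (hbar : ℂ))⁻¹ • W))

theorem _root_.coeff_mul_of_coeff_eq_zero_left {A : Type*} [Ring A] {P : PowerSeries A} {n : ℕ}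
    (h : ∀ i < n, PowerSeries.coeff i P = 0) (Q : PowerSeries A) :
    PowerSeries.coeff n (P * Q) = PowerSeries.coeff n P * PowerSeries.coeff 0 Q := by
  rw [PowerSeries.coeff_mul, Finset.sum_eq_single_of_mem (n, 0) (by simp)]
  intro p hp hne
  have hp := Finset.HasAntidiagonal.mem_antidiagonal.1 hp
  have h0 : p.2 ≠ 0 := fun h0 => hne (Prod.ext (by simp only; omega) h0)
  rw [h _ (by omega), zero_mul]

theorem _root_.coeff_mul_of_coeff_eq_zero_right {A : Type*} [Ring A] {P : PowerSeries A} {n : ℕ}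
    (h : ∀ i < n, PowerSeries.coeff i P = 0) (Q : PowerSeries A) :
    PowerSeries.coeff n (Q * P) = PowerSeries.coeff 0 Q * PowerSeries.coeff n P := by
  rw [PowerSeries.coeff_mul, Finset.sum_eq_single_of_mem (0, n) (by simp)]
  intro p hp hne
  have hp := Finset.HasAntidiagonal.mem_antidiagonal.1 hp
  have h0 : p.1 ≠ 0 := fun h0 => hne (Prod.ext h0 (by simp only; omega))
  rw [h _ (by omega), mul_zero]

theorem _root_.coeff_zero_mul_eq {A : Type*} [Ring A] (P Q : PowerSeries A) :
    PowerSeries.coeff 0 (P * Q) = PowerSeries.coeff 0 P * PowerSeries.coeff 0 Q :=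
  coeff_mul_of_coeff_eq_zero_left (fun i hi => absurd hi (Nat.not_lt_zero i)) Q

/-- The linearization behind the homological equation: V enters with a factor μ, so at the first
order where the generators differ only H₀ is seen. -/
theorem coeff_conjugate_sub {W W' : PowerSeries (Module.End ℂ S.core)}
    (hW : PowerSeries.coeff 0 W = 0) (hW' : PowerSeries.coeff 0 W' = 0) {n : ℕ} (hn : n ≠ 0)
    (h : ∀ i < n, PowerSeries.coeff i W = PowerSeries.coeff i W') :
    PowerSeries.coeff n (conjugate hh hV W) - PowerSeries.coeff n (conjugate hh hV W') =
      (Complex.I * (hbar : ℂ))⁻¹ •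
        ((PowerSeries.coeff n W - PowerSeries.coeff n W') * S.coreOp -
          S.coreOp * (PowerSeries.coeff n W - PowerSeries.coeff n W')) := by
  set c := (Complex.I * (hbar : ℂ))⁻¹
  have hc {W : PowerSeries (Module.End ℂ S.core)} (hW : PowerSeries.coeff 0 W = 0) :
      PowerSeries.coeff 0 (c • W) = 0 ∧ PowerSeries.coeff 0 (-(c • W)) = 0 := by
    rw [map_neg, PowerSeries.coeff_smul, hW, smul_zero, neg_zero]
    exact ⟨rfl, rfl⟩
  have hlt : ∀ i < n, PowerSeries.coeff i (c • W) = PowerSeries.coeff i (c • W') := fun i hi => by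
    rw [PowerSeries.coeff_smul, PowerSeries.coeff_smul, h i hi]
  have hlt' : ∀ i < n, PowerSeries.coeff i (-(c • W)) = PowerSeries.coeff i (-(c • W')) :=
    fun i hi => by rw [map_neg, map_neg, hlt i hi]
  set K := PowerSeries.C S.coreOp + PowerSeries.X * PowerSeries.C (S.corePerturbation hh hV)
    with hK
  have hK0 : PowerSeries.coeff 0 K = S.coreOp := by simp [hK]
  -- Each difference of exponentials starts at order n, so only the constant terms of the remaining
  -- factors matter there.
  have hsplit : conjugate hh hV W - conjugate hh hV W' =
      (formalExp (c • W) - formalExp (c • W')) * (K * formalExp (-(c • W))) +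
        formalExp (c • W') * K * (formalExp (-(c • W)) - formalExp (-(c • W'))) := by
    have key (a a' b b' x : PowerSeries (Module.End ℂ S.core)) :
        a * x * b - a' * x * b' = (a - a') * (x * b) + a' * x * (b - b') := by
      rw [sub_mul, mul_sub, mul_assoc a x b, mul_assoc a' x b, sub_add_sub_cancel]
    exact key _ _ _ _ _
  have hcoeff {i : ℕ} {P Q : PowerSeries (Module.End ℂ S.core)}
      (hPQ : PowerSeries.coeff i P = PowerSeries.coeff i Q) : PowerSeries.coeff i (P - Q) = 0 := by
    rw [map_sub, hPQ, sub_self]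
  rw [← map_sub, hsplit, map_add,
    coeff_mul_of_coeff_eq_zero_left fun i hi => hcoeff (coeff_formalExp_congr hlt hi),
    coeff_mul_of_coeff_eq_zero_right fun i hi => hcoeff (coeff_formalExp_congr hlt' hi),
    map_sub, map_sub, coeff_formalExp_sub (hc hW).1 (hc hW').1 hn hlt,
    coeff_formalExp_sub (hc hW).2 (hc hW').2 hn hlt', coeff_zero_mul_eq,
    coeff_zero_mul_eq, hK0, coeff_zero_formalExp, coeff_zero_formalExp, mul_one, one_mul,
    map_neg, map_neg, PowerSeries.coeff_smul, PowerSeries.coeff_smul]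
  have key {A : Type _} [Ring A] [Algebra ℂ A] (a b x : A) :
      (c • a - c • b) * x + x * (-(c • a) - -(c • b)) = c • ((a - b) * x - x * (a - b)) := by
    simp only [← smul_sub, ← smul_neg, smul_mul_assoc, mul_smul_comm, ← smul_add]
    congr 1
    noncomm_ring
  exact key _ _ _

/-- As 1/(iħ) is purely imaginary, W/(iħ) is formally skew-adjoint, so the two exponentials are
formal adjoints of each other. -/
theorem isSymmetric_coeff_conjugate (hsa : IsSelfAdjoint V)
    {W : PowerSeries (Module.End ℂ S.core)}
    (hW : ∀ k, (PowerSeries.coeff k W : Module.End ℂ S.core).IsSymmetric) (k : ℕ) :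
    (PowerSeries.coeff k (conjugate hh hV W) : Module.End ℂ S.core).IsSymmetric := by
  set c := (Complex.I * (hbar : ℂ))⁻¹ with hc
  have hcc : (starRingEnd ℂ) c = -c := by
    rw [hc, map_inv₀, map_mul, Complex.conj_I, Complex.conj_ofReal, neg_mul, inv_neg]
  have h1 : IsFormalAdjoint (c • W) (-(c • W)) := by
    rw [← neg_smul, ← hcc]
    exact IsFormalAdjoint.smul (fun k => hW k) c
  have h2 : IsFormalAdjoint (-(c • W)) (c • W) := by
    have := IsFormalAdjoint.smul (P := W) (Q := W) (fun k => hW k) (-c)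
    rwa [map_neg, hcc, neg_neg, neg_smul] at this
  have h3 : IsFormalAdjoint
      (PowerSeries.C S.coreOp + PowerSeries.X * PowerSeries.C (S.corePerturbation hh hV))
      (PowerSeries.C S.coreOp + PowerSeries.X * PowerSeries.C (S.corePerturbation hh hV)) := by
    intro k x y
    rw [map_add]
    rcases k with _ | _ | k
    · simpa using isSymmetric_coreOp x y
    · simpa [PowerSeries.coeff_C, PowerSeries.coeff_succ_X_mul] using
        isSymmetric_corePerturbation hh hsa hV x y
    · simp [PowerSeries.coeff_X]
  have h4 := (h1.formalExp.mul h3).mul h2.formalExp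
  rw [← mul_assoc] at h4
  exact h4 k

/-- The successive approximations of the normalizing generator. -/
def generatorApprox : ℕ → PowerSeries (Module.End ℂ S.core)
  | 0 => 0
  | n + 1 => generatorApprox n + PowerSeries.monomial (n + 1) (homologicalSolution hbar
      (PowerSeries.coeff (n + 1) (conjugate hh hV (generatorApprox n))))

theorem coeff_generatorApprox_of_lt {n j : ℕ} (h : n < j) :
    PowerSeries.coeff j (generatorApprox hh hV n) = 0 := by
  induction n with
  | zero => rw [generatorApprox, map_zero]
  | succ n ih =>
    rw [generatorApprox, map_add, ih (by omega), PowerSeries.coeff_monomial, if_neg (by omega),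
      add_zero]

theorem coeff_generatorApprox_of_le {n j : ℕ} (h : j ≤ n) :
    PowerSeries.coeff j (generatorApprox hh hV n) =
      PowerSeries.coeff j (generatorApprox hh hV j) := by
  induction n, h using Nat.le_induction with
  | base => rfl
  | succ n hn ih =>
    rw [generatorApprox, map_add, ih, PowerSeries.coeff_monomial, if_neg (by omega), add_zero]

/-- The normalizing generator. -/
def generator : PowerSeries (Module.End ℂ S.core) :=
  PowerSeries.mk fun n => PowerSeries.coeff n (generatorApprox hh hV n)

theorem coeff_generator {n j : ℕ} (h : j ≤ n) :
    PowerSeries.coeff j (generator hh hV) = PowerSeries.coeff j (generatorApprox hh hV n) := by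
  rw [generator, PowerSeries.coeff_mk, coeff_generatorApprox_of_le hh hV h]

theorem isSymmetric_coeff_generatorApprox (hsa : IsSelfAdjoint V) (n k : ℕ) :
    (PowerSeries.coeff k (generatorApprox hh hV n) : Module.End ℂ S.core).IsSymmetric := by
  induction n generalizing k with
  | zero =>
    rw [generatorApprox, map_zero]
    exact LinearMap.IsSymmetric.zero
  | succ n ih =>
    rw [generatorApprox, map_add, PowerSeries.coeff_monomial]
    refine (ih k).add ?_
    split_ifs
    · exact isSymmetric_homologicalSolution hbar (isSymmetric_coeff_conjugate hh hV hsa ih _)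
    · exact LinearMap.IsSymmetric.zero

theorem exists_isRayleighSchrodinger (hsa : IsSelfAdjoint V) :
    ∃ W N, S.IsRayleighSchrodinger hh hV W N := by
  have hW0 : PowerSeries.coeff 0 (generator hh hV) = 0 := by
    rw [coeff_generator hh hV le_rfl, generatorApprox, map_zero]
  have hzero : PowerSeries.coeff 0 (conjugate hh hV (generator hh hV)) = S.coreOp := by
    rw [conjugate, coeff_zero_mul_eq, coeff_zero_mul_eq, coeff_zero_formalExp,
      coeff_zero_formalExp]
    simp
  refine ⟨generator hh hV, conjugate hh hV (generator hh hV) - PowerSeries.C S.coreOp, hW0,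
    fun k => ?_, ?_, (add_sub_cancel _ _).symm, fun k => ?_⟩
  · rw [coeff_generator hh hV le_rfl]
    exact isSymmetric_coeff_generatorApprox hh hV hsa k k
  · rw [map_sub, hzero, PowerSeries.coeff_zero_C, sub_self]
  · cases k with
    | zero => rw [map_sub, hzero, PowerSeries.coeff_zero_C, sub_self, mul_zero, zero_mul]
    | succ n =>
      -- At order n + 1 the generator differs from its n-th approximation by exactly the homological
      -- solution, which removes the off-diagonal entries.
      have h1 := coeff_conjugate_sub hh hV (W := generator hh hV) (W' := generatorApprox hh hV n)
        hW0 (by rw [← coeff_generator hh hV (Nat.zero_le n), hW0]) (Nat.succ_ne_zero n)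
        fun i hi => coeff_generator hh hV (by omega)
      rw [coeff_generatorApprox_of_lt hh hV (Nat.lt_succ_self n), sub_zero,
        coeff_generator hh hV le_rfl, generatorApprox, map_add,
        coeff_generatorApprox_of_lt hh hV (Nat.lt_succ_self n), zero_add,
        PowerSeries.coeff_monomial, if_pos rfl, sub_eq_iff_eq_add'] at h1
      rw [map_sub, PowerSeries.coeff_C, if_neg (Nat.succ_ne_zero n), sub_zero, h1]
      exact (commute_homologicalSolution hh _).eq

end Existence

end SimpleHamiltonian

/-! ### The operator normal form obtained from the Birkhoff factors -/

namespace SimpleHamiltonian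

variable {H : Type*} [NormedAddCommGroup H] [InnerProductSpace ℂ H] [CompleteSpace H] {J : Set ℕ}
  {S : SimpleHamiltonian H J} {hbar : ℝ} (hh : 0 < hbar) {V : H →L[ℂ] H}
  (hV : S.FiniteBand hbar V)

variable (S hbar V) in
/-- The letter `V_z / (iħ)` attached to a frequency. -/
def letter (z : S.frequencies hbar) : Module.End ℂ S.core :=
  (Complex.I * (hbar : ℂ))⁻¹ • S.component hbar V z

/-- The formal conjugation built from the regular factor of a Birkhoff decomposition. -/
def mouldConjugator (P : Mould (S.frequencies hbar)) : PowerSeries (Module.End ℂ S.core) :=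
  contract (band hV) (S.letter hbar V) fun w => (P w.reverse).coeff 0

/-- The normal form built from the polar factor of a Birkhoff decomposition. -/
def mouldNormalForm (U : Mould (S.frequencies hbar)) : PowerSeries (Module.End ℂ S.core) :=
  (Complex.I * (hbar : ℂ)) • contract (band hV) (S.letter hbar V) (scaledNormalCoeff U)

theorem letter_bracket (hh : 0 < hbar) (z : S.frequencies hbar) :
    ((Complex.I * (hbar : ℂ))⁻¹ • S.coreOp) * S.letter hbar V z -
      S.letter hbar V z * ((Complex.I * (hbar : ℂ))⁻¹ • S.coreOp) =
        (z : ℂ) • S.letter hbar V z := by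
  have h0 : Complex.I * (hbar : ℂ) ≠ 0 :=
    mul_ne_zero Complex.I_ne_zero (by exact_mod_cast hh.ne')
  have key {A : Type _} [Ring A] [Algebra ℂ A] (c : ℂ) (a b : A) :
      (c • a) * (c • b) - (c • b) * (c • a) = c • c • (a * b - b * a) := by
    simp only [smul_mul_assoc, mul_smul_comm, smul_sub]
  refine (key _ _ _).trans ?_
  rw [letter, coreOp_bracket_component hh, mul_smul, inv_smul_smul₀ h0, smul_comm]

theorem C_coreOp_eq (hh : 0 < hbar) : PowerSeries.C S.coreOp =
    (Complex.I * (hbar : ℂ)) • PowerSeries.C ((Complex.I * (hbar : ℂ))⁻¹ • S.coreOp) := by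
  have h0 : Complex.I * (hbar : ℂ) ≠ 0 :=
    mul_ne_zero Complex.I_ne_zero (by exact_mod_cast hh.ne')
  ext1 n
  rw [PowerSeries.coeff_smul, PowerSeries.coeff_C, PowerSeries.coeff_C]
  split_ifs
  · rw [smul_inv_smul₀ h0]
  · rw [smul_zero]

variable {P U : Mould (S.frequencies hbar)}

/-- This is `plus_equation` contracted with the letters: the frequency sum becomes the bracket with
H₀/(iħ), and `dropHead` becomes right multiplication by μV/(iħ). -/
theorem mouldNormalForm_conj (hh : 0 < hbar)
    (h : IsBirkhoffDecomposition (regularizedMould Subtype.val) P U) :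
    mouldConjugator hV P *
        (PowerSeries.C S.coreOp + PowerSeries.X * PowerSeries.C (S.corePerturbation hh hV)) =
      (PowerSeries.C S.coreOp + mouldNormalForm hV U) * mouldConjugator hV P := by
  have h0 : Complex.I * (hbar : ℂ) ≠ 0 :=
    mul_ne_zero Complex.I_ne_zero (by exact_mod_cast hh.ne')
  have h1 := congrArg (contract (band hV) (S.letter hbar V)) (funext h.plus_equation)
  rw [contract_add, contract_conv, ← bracket_contract _ _ (letter_bracket hh),
    contract_dropHead] at h1
  have h2 : PowerSeries.X * PowerSeries.C (S.corePerturbation hh hV) =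
      (Complex.I * (hbar : ℂ)) •
        (PowerSeries.C (∑ a ∈ band hV, S.letter hbar V a) * PowerSeries.X) := by
    rw [corePerturbation_eq_sum]
    ext1 n
    cases n with
    | zero => simp
    | succ n =>
      rw [PowerSeries.coeff_succ_X_mul, PowerSeries.coeff_smul, PowerSeries.coeff_succ_mul_X,
        PowerSeries.coeff_C, PowerSeries.coeff_C]
      split_ifs
      · simp only [letter, ← Finset.smul_sum, smul_inv_smul₀ h0]
      · rw [smul_zero]
  rw [h2, C_coreOp_eq hh, mouldNormalForm, ← smul_add, ← smul_add, mul_smul_comm, smul_mul_assoc]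
  congr 1
  rw [mul_add, add_mul, mouldConjugator, ← mul_assoc, ← h1]
  abel

theorem coeff_zero_mouldConjugator (h : IsBirkhoffDecomposition (regularizedMould Subtype.val) P U) :
    PowerSeries.coeff 0 (mouldConjugator hV P) = 1 := by
  rw [mouldConjugator, coeff_contract, wordSum_zero, List.reverse_nil, h.plus_nil]
  simp

theorem coeff_zero_mouldNormalForm (U : Mould (S.frequencies hbar)) :
    PowerSeries.coeff 0 (mouldNormalForm hV U) = 0 := by
  rw [mouldNormalForm, PowerSeries.coeff_smul, coeff_contract, wordSum_zero]
  simp [scaledNormalCoeff]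

theorem commute_mouldNormalForm (hh : 0 < hbar)
    (h : IsBirkhoffDecomposition (regularizedMould Subtype.val) P U) (k : ℕ) :
    Commute S.coreOp (PowerSeries.coeff k (mouldNormalForm hV U)) := by
  have h0 : Complex.I * (hbar : ℂ) ≠ 0 :=
    mul_ne_zero Complex.I_ne_zero (by exact_mod_cast hh.ne')
  have h1 := bracket_contract (band hV) (S.letter hbar V) (letter_bracket hh) (scaledNormalCoeff U)
  have h2 : (fun w : List (S.frequencies hbar) =>
      (w.map Subtype.val).sum * scaledNormalCoeff U w) = fun _ => 0 := by
    funext w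
    by_cases hw : (w.map Subtype.val).sum = 0
    · rw [hw, zero_mul]
    · rw [(h.resonant w hw).2, mul_zero]
  rw [h2] at h1
  have h3 := congrArg (PowerSeries.coeff k) h1
  rw [map_sub, PowerSeries.coeff_C_mul, PowerSeries.coeff_mul_C, coeff_contract _ _ fun _ => 0,
    wordSum_eq_zero _ fun w _ => zero_smul _ _, smul_mul_assoc, mul_smul_comm] at h3
  have h4 := smul_right_injective _ (inv_ne_zero h0) (sub_eq_zero.1 h3)
  rw [mouldNormalForm, PowerSeries.coeff_smul]
  exact Commute.smul_right h4 _

/-- The length k in `scaledNormalCoeff` is exactly the factor of the Dynkin–Specht–Wever identity,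
applicable because the residues are alternal. -/
theorem coeff_mouldNormalForm (hh : 0 < hbar)
    (h : IsBirkhoffDecomposition (regularizedMould Subtype.val) P U) {k : ℕ} (hk : k ≠ 0) :
    PowerSeries.coeff k (mouldNormalForm hV U) =
      ∑ z ∈ Fintype.piFinset fun _ : Fin k => band hV, S.expansionTerm hbar V U z := by
  have h0 : Complex.I * (hbar : ℂ) ≠ 0 :=
    mul_ne_zero Complex.I_ne_zero (by exact_mod_cast hh.ne')
  have halt : IsAlternal (normalCoeff U) := h.isAlternal_normalCoeff (regularizedMould_nil _)
    (isSymmetral_regularizedMould _)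
  have hsum : (∑ z ∈ Fintype.piFinset fun _ : Fin k => band hV, S.expansionTerm hbar V U z) =
      wordSum (band hV) k fun w => (-laurentResidue (U w)) •
        nestedBracket hbar (w.map fun z : S.frequencies hbar => S.component hbar V z) := by
    refine Finset.sum_congr rfl fun z _ => ?_
    beta_reduce
    rw [expansionTerm, List.map_ofFn]
    rfl
  rw [hsum, ← wordSum_reverse]
  simp only [nestedBracket_reverse h0]
  rw [mouldNormalForm, PowerSeries.coeff_smul, coeff_contract]
  have h2 := halt.wordSum_smul_wordBracket (band hV) (S.letter hbar V) hk
  have h3 : (wordSum (band hV) k fun w => scaledNormalCoeff U w • revProd (S.letter hbar V) w) =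
      (k : ℂ) • wordSum (band hV) k fun w => normalCoeff U w • revProd (S.letter hbar V) w := by
    rw [smul_wordSum]
    refine wordSum_congr _ fun w hw => ?_
    rw [scaledNormalCoeff, hw, mul_smul]
  rw [h3, ← h2, smul_wordSum]
  exact wordSum_congr _ fun w _ => smul_comm _ _ _

/-- The normal form given by the Lie algorithm is the one given by the Birkhoff decomposition. -/
theorem IsRayleighSchrodinger.eq_mouldNormalForm {W N : PowerSeries (Module.End ℂ S.core)}
    (hWN : S.IsRayleighSchrodinger hh hV W N)
    (h : IsBirkhoffDecomposition (regularizedMould Subtype.val) P U) :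
    N = mouldNormalForm hV U := by
  set Y := (Complex.I * (hbar : ℂ))⁻¹ • W with hY
  have hY0 : PowerSeries.coeff 0 Y = 0 := by
    rw [hY, PowerSeries.coeff_smul, hWN.generator_zero, smul_zero]
  have hY0' : PowerSeries.coeff 0 (-Y) = 0 := by rw [map_neg, hY0, neg_zero]
  have hinv : formalExp (-Y) * formalExp Y = 1 := by
    have := formalExp_mul_formalExp_neg hY0'
    rwa [neg_neg] at this
  -- Undoing the Lie conjugation and then applying the mould one carries H₀ + N to the mould normal
  -- form.
  refine normalForm_unique (X := mouldConjugator hV P * formalExp (-Y)) ?_ hWN.normal_zero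
    (coeff_zero_mouldNormalForm hV U) hWN.commute (commute_mouldNormalForm hV hh h) ?_
  · rw [coeff_zero_mul_eq, coeff_zero_mouldConjugator hV h, coeff_zero_formalExp, mul_one]
  · rw [← hWN.conjugation, ← mul_assoc, ← mul_assoc, ← mul_assoc,
      mul_assoc (mouldConjugator hV P) (formalExp (-Y)), hinv, mul_one,
      mouldNormalForm_conj hV hh h]

theorem _root_.nestedBracket_eq_zero {A : Type*} [Ring A] [Algebra ℂ A] (hbar : ℝ) {l : List A}
    (h : (0 : A) ∈ l) : nestedBracket hbar l = 0 := by
  match l with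
  | [] => rfl
  | [a] => exact (List.mem_singleton.1 h).symm
  | a :: b :: l =>
    rw [nestedBracket, quantumBracket]
    rcases List.mem_cons.1 h with h | h
    · simp [← h]
    · rw [nestedBracket_eq_zero hbar h]
      simp

theorem support_expansionTerm_subset (U : Mould (S.frequencies hbar)) (k : ℕ) :
    (Function.support fun z : Fin k → S.frequencies hbar => S.expansionTerm hbar V U z) ⊆
      Fintype.piFinset fun _ : Fin k => band hV := by
  intro z hz
  rw [Finset.mem_coe, Fintype.mem_piFinset]
  intro i
  rw [mem_band]
  intro hi
  refine hz ?_
  simp only [expansionTerm]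
  rw [nestedBracket_eq_zero, smul_zero]
  rw [List.mem_ofFn]
  exact ⟨i, hi⟩

end SimpleHamiltonian

theorem theorem1p1 {H : Type*} [NormedAddCommGroup H] [InnerProductSpace ℂ H] [CompleteSpace H]
    {J : Set ℕ} (S : SimpleHamiltonian H J) {hbar : ℝ} (hh : 0 < hbar)
    (V : H →L[ℂ] H) (hsa : IsSelfAdjoint V) (hV : S.FiniteBand hbar V) :
    -- the mould `T` has a unique Birkhoff decomposition
    (∃! U : Mould (S.frequencies hbar) × Mould (S.frequencies hbar),
      IsBirkhoffDecomposition (regularizedMould Subtype.val) U.1 U.2) ∧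
    -- the Lie algorithm has a solution
    (∃ W N, S.IsRayleighSchrodinger hh hV W N) ∧
    ∀ Uplus Uminus : Mould (S.frequencies hbar),
      IsBirkhoffDecomposition (regularizedMould Subtype.val) Uplus Uminus →
      -- the residue of `U₋` on a nonempty word is the value of `ε U₋` at infinity
      (∀ w, w ≠ [] → HasValueAtInfinity (laurentEps * Uminus w) (laurentResidue (Uminus w))) ∧
      -- the expansion of the order-`k` term, as a sum with finitely many nonzero terms
      ∀ W N, S.IsRayleighSchrodinger hh hV W N → ∀ k, 1 ≤ k →
        (Function.support fun z : Fin k → S.frequencies hbar =>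
            S.expansionTerm hbar V Uminus z).Finite ∧
          PowerSeries.coeff k N =
            ∑ᶠ z : Fin k → S.frequencies hbar, S.expansionTerm hbar V Uminus z := by
  refine ⟨Mould.existsUnique_isBirkhoffDecomposition _ (regularizedMould_nil _),
    SimpleHamiltonian.exists_isRayleighSchrodinger hh hV hsa, fun Uplus Uminus h =>
    ⟨fun w hw => (h.isPolarPart hw).hasValueAtInfinity, fun W N hWN k hk => ?_⟩⟩
  have hsupp := SimpleHamiltonian.support_expansionTerm_subset hV Uminus k
  refine ⟨(Finset.finite_toSet _).subset hsupp, ?_⟩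
  rw [finsum_eq_sum_of_support_subset _ hsupp, hWN.eq_mouldNormalForm hh hV h,
    SimpleHamiltonian.coeff_mouldNormalForm hV hh h (Nat.one_le_iff_ne_zero.1 hk)]

end
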